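/- Let $k$ be an algebraically closed field, let $X$ be an irreducible projective variety over $k$ (an integral closed subscheme of some projective space $\mathbb P^n_k$), and let $E$ be a vector bundle of rank $d$ on $X$. By an étale covering of $X$ we mean a finite étale morphism of schemes $f\colon Y\to X$; here $Y$ need not be connected. The following two statements are equivalent: (1) There is an étale covering $f\colon Y\to X$ such that $f_*\mathcal O_Y$ is isomorphic to $E$ as an $\mathcal O_X$-module. (2) There is a homomorphism of $\mathcal O_X$-modules $\alpha\colon E\to \mathrm{End}(E)$ that is injective on fibers and such that for each closed point $x\in X$ the subspace $\alpha(E_x)\subset \mathrm{End}(E)_x=\mathrm{End}(E_x)$ is a Cartan subalgebra. Here $E_x$ denotes the fiber of $E$ at $x$, and a subspace of the endomorphism algebra of a $d$-dimensional vector space is called a Cartan subalgebra if it has dimension $d$ and its elements are simultaneously diagonal in some basis. Moreover, for every étale covering $f\colon Y\to X$ with $f_*\mathcal O_Y\cong E$, the scheme $Y$ has finitely many connected components, $H^0(X,E)$ is a finite-dimensional $k$-vector space, and the number of connected components of $Y$ is equal to $\dim_k H^0(X,E)$; if $d>0$, then $f$ is surjective. -/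

import Mathlib

universe u

open CategoryTheory AlgebraicGeometry TopologicalSpace Opposite
open scoped TensorProduct

noncomputable section
namespace CartanBundle

variable {X : Scheme.{u}}

/-! ### The endomorphism sheaf of a sheaf of modules -/

/-- Sections over `U` of `End(E)`: the `𝒪_U`-linear endomorphisms of `E|_U`, that is, the families
of `𝒪(V)`-linear endomorphisms of `E(V)`, for `V ⊆ U` open, which commute with restriction. -/
def endSections (E : X.Modules) (U : X.Opens) :
    AddSubgroup (∀ V : {V : X.Opens // V ≤ U}, Module.End Γ(X, V.1) Γ(E, V.1)) where
  carrier := {φ | ∀ (V W : {V : X.Opens // V ≤ U}) (h : W.1 ≤ V.1) (s : Γ(E, V.1)),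
    E.presheaf.map (homOfLE h).op (φ V s) = φ W (E.presheaf.map (homOfLE h).op s)}
  zero_mem' := by intro V W h s; simp
  add_mem' := by intro a b ha hb V W h s; simp [ha V W h s, hb V W h s]
  neg_mem' := by intro a ha V W h s; simp [ha V W h s]

lemma rmap_comp {U V W : X.Opens} (h : V ≤ U) (h' : W ≤ V) (r : Γ(X, U)) :
    X.presheaf.map (homOfLE h').op (X.presheaf.map (homOfLE h).op r) =
      X.presheaf.map (homOfLE (h'.trans h)).op r := by
  rw [← CommRingCat.comp_apply, ← Functor.map_comp]; rfl

lemma mmap_comp (E : X.Modules) {U V W : X.Opens} (h : V ≤ U) (h' : W ≤ V) (s : Γ(E, U)) :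
    E.presheaf.map (homOfLE h').op (E.presheaf.map (homOfLE h).op s) =
      E.presheaf.map (homOfLE (h'.trans h)).op s := by
  rw [← ConcreteCategory.comp_apply, ← Functor.map_comp]; rfl

/-- A function acts on an endomorphism of `E|_U` through its restrictions to the `V ⊆ U`. -/
instance (E : X.Modules) (U : X.Opens) : SMul Γ(X, U) (endSections E U) where
  smul r φ := ⟨fun V ↦ X.presheaf.map (homOfLE V.2).op r • φ.1 V, by
    intro V W h s
    have := Scheme.Modules.map_smul E (homOfLE h) (X.presheaf.map (homOfLE V.2).op r) (φ.1 V s)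
    rw [rmap_comp, φ.2 V W h s] at this
    exact this⟩

lemma smul_val (E : X.Modules) (U : X.Opens) (r : Γ(X, U)) (φ : endSections E U)
  (V : {V : X.Opens // V ≤ U}) : (r • φ).1 V = X.presheaf.map (homOfLE V.2).op r • φ.1 V := rfl

instance (E : X.Modules) (U : X.Opens) : Module Γ(X, U) (endSections E U) where
  one_smul φ := Subtype.ext <| funext fun V ↦ by rw [smul_val, map_one, one_smul]
  mul_smul r r' φ := Subtype.ext <| funext fun V ↦ by simp only [smul_val, map_mul, mul_smul]
  smul_zero r := Subtype.ext <| funext fun V ↦ smul_zero (X.presheaf.map (homOfLE V.2).op r)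
  smul_add r a b := Subtype.ext <| funext fun V ↦
    smul_add (X.presheaf.map (homOfLE V.2).op r) (a.1 V) (b.1 V)
  add_smul r r' a := Subtype.ext <| funext fun V ↦
    (congrArg (· • a.1 V) (map_add (X.presheaf.map (homOfLE V.2).op).hom r r')).trans
      (add_smul _ _ (a.1 V))
  zero_smul a := Subtype.ext <| funext fun V ↦
    (congrArg (· • a.1 V) (map_zero (X.presheaf.map (homOfLE V.2).op).hom)).trans
      (zero_smul _ (a.1 V))

/-- Restriction of an endomorphism of `E|_U` to a smaller open set. -/
def endRestrict (E : X.Modules) {U U' : X.Opens} (i : U' ≤ U) :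
    endSections E U →+ endSections E U' where
  toFun φ := ⟨fun V ↦ φ.1 ⟨V.1, V.2.trans i⟩, fun V W h s ↦
    φ.2 ⟨V.1, V.2.trans i⟩ ⟨W.1, W.2.trans i⟩ h s⟩
  map_zero' := rfl
  map_add' _ _ := rfl

/-- The presheaf of abelian groups `U ↦ End(E|_U)`. -/
def endPresheafAb (E : X.Modules) : TopCat.Presheaf Ab.{u} X where
  obj U := AddCommGrpCat.of (endSections E U.unop)
  map i := AddCommGrpCat.ofHom (endRestrict E i.unop.le)
  map_id _ := rfl
  map_comp _ _ := rfl

instance (E : X.Modules) (U : X.Opensᵒᵖ) :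
    Module (X.ringCatSheaf.obj.obj U) ((endPresheafAb E).obj U) :=
  inferInstanceAs (Module Γ(X, U.unop) (endSections E U.unop))

/-- The presheaf of modules `U ↦ End(E|_U)`. -/
def endPresheaf (E : X.Modules) : X.PresheafOfModules :=
  PresheafOfModules.ofPresheaf (endPresheafAb E) (by
    intro U U' i r φ
    refine Subtype.ext (funext fun V ↦ ?_)
    exact congrArg (· • φ.1 ⟨V.1, V.2.trans i.unop.le⟩) (rmap_comp i.unop.le V.2 r).symm)

lemma section_ext (E : X.Modules) {ι : Type*} {V : X.Opens} (U : ι → X.Opens) (hV : V ≤ iSup U)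
    (s t : Γ(E, V)) (h : ∀ i, E.presheaf.map (homOfLE (inf_le_left : V ⊓ U i ≤ V)).op s =
      E.presheaf.map (homOfLE (inf_le_left : V ⊓ U i ≤ V)).op t) : s = t :=
  TopCat.Sheaf.eq_of_locally_eq' ⟨E.presheaf, E.isSheaf⟩ (fun i ↦ V ⊓ U i) V
    (fun i ↦ homOfLE inf_le_left) (by rw [← inf_iSup_eq]; exact le_inf le_rfl hV) s t h

open TopCat.Presheaf in
lemma endPresheafAb_isSheaf (E : X.Modules) : TopCat.Presheaf.IsSheaf (endPresheafAb E) := by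
  rw [TopCat.Presheaf.isSheaf_iff_isSheafUniqueGluing]
  intro ι U sf hsf
  let φ (i : ι) : endSections E (U i) := sf i
  have hφ (i j : ι) (W : X.Opens) (hi : W ≤ U i) (hj : W ≤ U j) :
      (φ i).1 ⟨W, hi⟩ = (φ j).1 ⟨W, hj⟩ :=
    congr_fun (congrArg Subtype.val (hsf i j)) ⟨W, le_inf hi hj⟩
  have key (V : {V : X.Opens // V ≤ iSup U}) (s : Γ(E, V.1)) :
      ∃! t : Γ(E, V.1), ∀ i, E.presheaf.map (homOfLE (inf_le_left : V.1 ⊓ U i ≤ V.1)).op t =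
        (φ i).1 ⟨V.1 ⊓ U i, inf_le_right⟩ (E.presheaf.map (homOfLE inf_le_left).op s) := by
    refine TopCat.Sheaf.existsUnique_gluing' ⟨E.presheaf, E.isSheaf⟩ (fun i ↦ V.1 ⊓ U i) V.1
      (fun i ↦ homOfLE inf_le_left) (by rw [← inf_iSup_eq]; exact le_inf le_rfl V.2)
      (fun i ↦ (φ i).1 ⟨V.1 ⊓ U i, inf_le_right⟩ (E.presheaf.map (homOfLE inf_le_left).op s)) ?_
    intro i j
    have h1 := (φ i).2 ⟨V.1 ⊓ U i, inf_le_right⟩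
      ⟨(V.1 ⊓ U i) ⊓ (V.1 ⊓ U j), inf_le_left.trans inf_le_right⟩ inf_le_left
      (E.presheaf.map (homOfLE inf_le_left).op s)
    have h2 := (φ j).2 ⟨V.1 ⊓ U j, inf_le_right⟩
      ⟨(V.1 ⊓ U i) ⊓ (V.1 ⊓ U j), inf_le_right.trans inf_le_right⟩ inf_le_right
      (E.presheaf.map (homOfLE inf_le_left).op s)
    rw [mmap_comp] at h1 h2
    refine h1.trans (Eq.trans ?_ h2.symm)
    rw [hφ i j]
  choose g hg hg' using key
  have glin (V : {V : X.Opens // V ≤ iSup U}) :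
      ∃ G : Module.End Γ(X, V.1) Γ(E, V.1), ∀ s, G s = g V s := by
    refine ⟨{ toFun := g V, map_add' := ?_, map_smul' := ?_ }, fun _ ↦ rfl⟩
    · intro s t
      refine (hg' V (s + t) _ fun i ↦ ?_).symm
      rw [map_add, map_add, map_add, hg, hg]
    · intro r s
      refine (hg' V (r • s) _ fun i ↦ ?_).symm
      have h1 := Scheme.Modules.map_smul E (homOfLE (inf_le_left : V.1 ⊓ U i ≤ V.1)) r s
      have h2 := Scheme.Modules.map_smul E (homOfLE (inf_le_left : V.1 ⊓ U i ≤ V.1)) r (g V s)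
      simp only [RingHom.id_apply]
      rw [h1, h2, hg, map_smul]
  choose G hG using glin
  refine ⟨(⟨G, ?_⟩ : endSections E (iSup U)), ?_, ?_⟩
  · intro V W h s
    rw [hG, hG]
    refine hg' W _ _ fun i ↦ ?_
    have h1 := (φ i).2 ⟨V.1 ⊓ U i, inf_le_right⟩ ⟨W.1 ⊓ U i, inf_le_right⟩
      (inf_le_inf_right _ h) (E.presheaf.map (homOfLE inf_le_left).op s)
    rw [← hg, mmap_comp, mmap_comp] at h1
    rw [mmap_comp, mmap_comp]
    exact h1
  · intro i
    refine Subtype.ext (funext fun V ↦ LinearMap.ext fun s ↦ ?_)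
    refine (hG ⟨V.1, V.2.trans (le_iSup U i)⟩ s).trans ?_
    refine (hg' ⟨V.1, V.2.trans (le_iSup U i)⟩ s _ fun j ↦ ?_).symm
    have h1 := (φ i).2 V ⟨V.1 ⊓ U j, inf_le_left.trans V.2⟩ inf_le_left s
    exact h1.trans (by rw [hφ i j])
  · intro ψ hψ
    let ψ' : endSections E (iSup U) := ψ
    refine Subtype.ext (funext fun V ↦ LinearMap.ext fun s ↦ ?_)
    refine Eq.trans ?_ (hG V s).symm
    refine hg' V s _ fun i ↦ ?_
    have h1 := ψ'.2 V ⟨V.1 ⊓ U i, inf_le_left.trans V.2⟩ inf_le_left s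
    refine h1.trans ?_
    exact congrArg (fun f : endSections E (U i) ↦ f.1 ⟨V.1 ⊓ U i, inf_le_right⟩
      (E.presheaf.map (homOfLE inf_le_left).op s)) (hψ i)

/-- The sheaf of modules `End(E)`. -/
def endSheaf (E : X.Modules) : X.Modules where
  val := endPresheaf E
  isSheaf := endPresheafAb_isSheaf E

/-! ### Fibres -/

/-- The stalk `M_x` is a module over the local ring `𝒪_{X,x}`. -/
instance stalkModule (M : X.Modules) (x : X) :
    Module (X.presheaf.stalk x) (M.presheaf.stalk x) :=
  PresheafOfModules.instModuleCarrierStalkCommRingCatCarrierAbPresheafOpensCarrier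
    (R := X.presheaf) M.val x

lemma germ_smul (M : X.Modules) (x : X) (U : X.Opens) (hx : x ∈ U) (r : Γ(X, U)) (m : Γ(M, U)) :
    M.presheaf.germ U x hx (r • m) = X.presheaf.germ U x hx r • M.presheaf.germ U x hx m :=
  PresheafOfModules.germ_smul (R := X.presheaf) M.val x U hx r m


/-- The fibre `M(x) = κ(x) ⊗ M_x` of a sheaf of modules at a point, a vector space over the residue
field `κ(x)` of `x`. -/
abbrev Fiber (M : X.Modules) (x : X) : Type u :=
  IsLocalRing.ResidueField (X.presheaf.stalk x) ⊗[X.presheaf.stalk x] M.presheaf.stalk x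

lemma germ_restrict (M : X.Modules) {x : X} {U V : X.Opens} (h : V ≤ U) (hx : x ∈ V)
    (m : Γ(M, U)) : M.presheaf.germ V x hx (M.presheaf.map (homOfLE h).op m) =
      M.presheaf.germ U x (h hx) m :=
  TopCat.Presheaf.germ_res_apply M.presheaf (homOfLE h) x hx m

lemma exists_germ_pair (M : X.Modules) {x : X} (W : X.Opens) (hW : x ∈ W)
    (r : X.presheaf.stalk x) (m : M.presheaf.stalk x) :
    ∃ (U : X.Opens) (hx : x ∈ U) (_ : U ≤ W) (r' : Γ(X, U)) (m' : Γ(M, U)),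
      X.presheaf.germ U x hx r' = r ∧ M.presheaf.germ U x hx m' = m := by
  obtain ⟨U, hU, r, rfl⟩ := TopCat.Presheaf.exists_germ_eq X.presheaf r
  obtain ⟨V, hV, m, rfl⟩ := TopCat.Presheaf.exists_germ_eq M.presheaf m
  exact ⟨U ⊓ V ⊓ W, ⟨⟨hU, hV⟩, hW⟩, inf_le_right,
    X.presheaf.map (homOfLE (inf_le_left.trans inf_le_left)).op r,
    M.presheaf.map (homOfLE (inf_le_left.trans inf_le_right)).op m,
    TopCat.Presheaf.germ_res_apply X.presheaf (homOfLE (inf_le_left.trans inf_le_left)) x _ r,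
    germ_restrict M (inf_le_left.trans inf_le_right) _ m⟩

/-- The `𝒪_{X,x}`-linear map `M_x → N_x` on stalks induced by `φ : M → N`. -/
def stalkMap {M N : X.Modules} (φ : M ⟶ N) (x : X) :
    M.presheaf.stalk x →ₗ[X.presheaf.stalk x] N.presheaf.stalk x where
  toFun := (TopCat.Presheaf.stalkFunctor Ab.{u} x).map φ.mapPresheaf
  map_add' := map_add _
  map_smul' r m := by
    obtain ⟨U, hU, -, r, m, rfl, rfl⟩ := exists_germ_pair M ⊤ trivial r m
    rw [← germ_smul, TopCat.Presheaf.stalkFunctor_map_germ_apply,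
      TopCat.Presheaf.stalkFunctor_map_germ_apply, Scheme.Modules.mapPresheaf_app]
    exact (congrArg _ (Scheme.Modules.Hom.app_smul φ r m)).trans (germ_smul N x U hU r (φ.app U m))

/-- The `κ(x)`-linear map `φ(x) : M(x) → N(x)` on fibres induced by `φ : M → N`. -/
def fiberMap {M N : X.Modules} (φ : M ⟶ N) (x : X) :
    Fiber M x →ₗ[IsLocalRing.ResidueField (X.presheaf.stalk x)] Fiber N x :=
  (stalkMap φ x).baseChange _

/-- The additive endomorphism of the stalk `E_x` induced by an endomorphism `φ` of `E|_U`: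
the germ of `s` goes to the germ of `φ(s)`. -/
def endGermHom (E : X.Modules) (x : X) (U : X.Opens) (hx : x ∈ U) (φ : endSections E U) :
    E.presheaf.stalk x ⟶ E.presheaf.stalk x :=
  Limits.colimit.desc ((OpenNhds.inclusion x).op ⋙ E.presheaf)
    { pt := E.presheaf.stalk x
      ι :=
      { app V := E.presheaf.map (homOfLE (inf_le_left : V.unop.1 ⊓ U ≤ V.unop.1)).op ≫
          AddCommGrpCat.ofHom (φ.1 ⟨V.unop.1 ⊓ U, inf_le_right⟩).toAddMonoidHom ≫
          E.presheaf.germ (V.unop.1 ⊓ U) x ⟨V.unop.2, hx⟩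
        naturality V W i := by
          ext s
          have hle : W.unop.1 ≤ V.unop.1 := leOfHom i.unop
          let s' : Γ(E, V.unop.1) := s
          have h1 := φ.2 ⟨V.unop.1 ⊓ U, inf_le_right⟩ ⟨W.unop.1 ⊓ U, inf_le_right⟩
            (inf_le_inf_right U hle) (E.presheaf.map (homOfLE inf_le_left).op s')
          have h2 := germ_restrict E (x := x) (inf_le_inf_right U hle) ⟨W.unop.2, hx⟩
            (φ.1 ⟨V.unop.1 ⊓ U, inf_le_right⟩ (E.presheaf.map (homOfLE inf_le_left).op s'))
          rw [h1, mmap_comp] at h2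
          refine Eq.trans ?_ h2
          refine congrArg (fun t ↦ E.presheaf.germ (W.unop.1 ⊓ U) x ⟨W.unop.2, hx⟩
            (φ.1 ⟨W.unop.1 ⊓ U, inf_le_right⟩ t)) ?_
          exact mmap_comp E hle inf_le_left s' } }

lemma endGermHom_germ (E : X.Modules) (x : X) (U : X.Opens) (hx : x ∈ U) (φ : endSections E U)
    (V : X.Opens) (hV : x ∈ V) (s : Γ(E, V)) :
    endGermHom E x U hx φ (E.presheaf.germ V x hV s) =
      E.presheaf.germ (V ⊓ U) x ⟨hV, hx⟩ (φ.1 ⟨V ⊓ U, inf_le_right⟩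
        (E.presheaf.map (homOfLE inf_le_left).op s)) :=
  ConcreteCategory.congr_hom (Limits.colimit.ι_desc (F := ((OpenNhds.inclusion x).op ⋙ E.presheaf))
    _ (op ⟨V, hV⟩)) s

lemma endGermHom_germ_of_le (E : X.Modules) (x : X) (U : X.Opens) (hx : x ∈ U)
    (φ : endSections E U) (V : X.Opens) (hV : x ∈ V) (hVU : V ≤ U) (s : Γ(E, V)) :
    endGermHom E x U hx φ (E.presheaf.germ V x hV s) =
      E.presheaf.germ V x hV (φ.1 ⟨V, hVU⟩ s) := by
  rw [endGermHom_germ, ← φ.2 ⟨V, hVU⟩ ⟨V ⊓ U, inf_le_right⟩ inf_le_left s]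
  exact germ_restrict E inf_le_left _ _

lemma exists_germ_le (M : X.Modules) {x : X} (U : X.Opens) (hU : x ∈ U) (m : M.presheaf.stalk x) :
    ∃ (V : X.Opens) (hx : x ∈ V) (_ : V ≤ U) (m' : Γ(M, V)), M.presheaf.germ V x hx m' = m := by
  obtain ⟨V, hV, m, rfl⟩ := TopCat.Presheaf.exists_germ_eq M.presheaf m
  exact ⟨V ⊓ U, ⟨hV, hU⟩, inf_le_right, _, germ_restrict M inf_le_left _ m⟩

/-- The `𝒪_{X,x}`-linear endomorphism of `E_x` induced by an endomorphism of `E|_U`. -/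
def endGerm (E : X.Modules) (x : X) (U : X.Opens) (hx : x ∈ U) (φ : endSections E U) :
    Module.End (X.presheaf.stalk x) (E.presheaf.stalk x) where
  toFun := endGermHom E x U hx φ
  map_add' := map_add _
  map_smul' r m := by
    obtain ⟨V, hV, hVU, r, m, rfl, rfl⟩ := exists_germ_pair E U hx r m
    rw [RingHom.id_apply, ← germ_smul, endGermHom_germ_of_le E x U hx φ V hV hVU,
      endGermHom_germ_of_le E x U hx φ V hV hVU, ← germ_smul, map_smul]

lemma endGerm_germ_of_le (E : X.Modules) (x : X) (U : X.Opens) (hx : x ∈ U)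
    (φ : endSections E U) (V : X.Opens) (hV : x ∈ V) (hVU : V ≤ U) (s : Γ(E, V)) :
    endGerm E x U hx φ (E.presheaf.germ V x hV s) =
      E.presheaf.germ V x hV (φ.1 ⟨V, hVU⟩ s) :=
  endGermHom_germ_of_le E x U hx φ V hV hVU s

/-- `endGerm` as an additive map. -/
def endGermAdd (E : X.Modules) (x : X) (U : X.Opens) (hx : x ∈ U) :
    endSections E U →+ Module.End (X.presheaf.stalk x) (E.presheaf.stalk x) :=
  AddMonoidHom.mk' (endGerm E x U hx) fun a b ↦ LinearMap.ext fun m ↦ by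
    obtain ⟨V, hV, hVU, m, rfl⟩ := exists_germ_le E U hx m
    rw [LinearMap.add_apply, endGerm_germ_of_le _ _ _ _ _ V hV hVU,
      endGerm_germ_of_le _ _ _ _ _ V hV hVU, endGerm_germ_of_le _ _ _ _ _ V hV hVU, ← map_add]
    rfl

/-- The additive map `End(E)_x → End(E_x)` on stalks: the germ of an endomorphism `φ` of `E|_U`
acts on `E_x` by `s_x ↦ φ(s)_x`. -/
def endStalkHom (E : X.Modules) (x : X) : (endSheaf E).presheaf.stalk x ⟶
    AddCommGrpCat.of (Module.End (X.presheaf.stalk x) (E.presheaf.stalk x)) :=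
  Limits.colimit.desc ((OpenNhds.inclusion x).op ⋙ (endSheaf E).presheaf)
    { pt := AddCommGrpCat.of (Module.End (X.presheaf.stalk x) (E.presheaf.stalk x))
      ι :=
      { app U := AddCommGrpCat.ofHom (endGermAdd E x U.unop.1 U.unop.2)
        naturality U U' i := by
          ext φ
          refine LinearMap.ext fun m ↦ ?_
          have hle : U'.unop.1 ≤ U.unop.1 := leOfHom i.unop
          obtain ⟨V, hV, hVU, m, rfl⟩ := exists_germ_le E U'.unop.1 U'.unop.2 m
          exact (endGerm_germ_of_le E x U'.unop.1 U'.unop.2 (endRestrict E hle φ) V hV hVU m).trans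
            (endGerm_germ_of_le E x U.unop.1 U.unop.2 φ V hV (hVU.trans hle) m).symm } }

lemma endStalkHom_germ (E : X.Modules) (x : X) (U : X.Opens) (hx : x ∈ U) (φ : endSections E U) :
    endStalkHom E x ((endSheaf E).presheaf.germ U x hx φ) = endGerm E x U hx φ :=
  ConcreteCategory.congr_hom (Limits.colimit.ι_desc
    (F := ((OpenNhds.inclusion x).op ⋙ (endSheaf E).presheaf)) _ (op ⟨U, hx⟩)) φ

/-- The canonical `𝒪_{X,x}`-linear map `End(E)_x → End(E_x)` from the stalk of `End(E)` to the
endomorphisms of the stalk of `E`. -/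
def endStalkMap (E : X.Modules) (x : X) : (endSheaf E).presheaf.stalk x →ₗ[X.presheaf.stalk x]
    Module.End (X.presheaf.stalk x) (E.presheaf.stalk x) where
  toFun := endStalkHom E x
  map_add' := map_add _
  map_smul' r φ := by
    obtain ⟨U, hU, -, r, φ, rfl, rfl⟩ := exists_germ_pair (endSheaf E) ⊤ trivial r φ
    refine LinearMap.ext fun m ↦ ?_
    obtain ⟨V, hV, hVU, m, rfl⟩ := exists_germ_le E U hU m
    let φ' : endSections E U := φ
    have h1 := endStalkHom_germ E x U hU φ'
    have h2 : endStalkHom E x ((endSheaf E).presheaf.germ U x hU (r • φ)) =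
      endGerm E x U hU (r • φ') := endStalkHom_germ E x U hU (r • φ')
    have h3 := TopCat.Presheaf.germ_res_apply X.presheaf (homOfLE hVU) x hV r
    rw [← germ_smul, h2, RingHom.id_apply, h1, LinearMap.smul_apply,
      endGerm_germ_of_le E x U hU _ V hV hVU m, endGerm_germ_of_le E x U hU _ V hV hVU m,
      smul_val, LinearMap.smul_apply, germ_smul]
    exact congrArg (· • E.presheaf.germ V x hV (φ'.1 ⟨V, hVU⟩ m)) h3

/-- The canonical `κ(x)`-linear map `End(E)(x) → End(E(x))` from the fibre of `End(E)` to the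
endomorphisms of the fibre of `E`: it sends `c ⊗ φ_x` to `c · (id ⊗ φ_x)`. For a vector bundle `E`
it is the usual identification of the two. -/
def endFiberMap (E : X.Modules) (x : X) :
    Fiber (endSheaf E) x →ₗ[IsLocalRing.ResidueField (X.presheaf.stalk x)]
      Module.End (IsLocalRing.ResidueField (X.presheaf.stalk x)) (Fiber E x) :=
  ((LinearMap.baseChangeHom (X.presheaf.stalk x) (IsLocalRing.ResidueField (X.presheaf.stalk x))
    (E.presheaf.stalk x) (E.presheaf.stalk x)).comp (endStalkMap E x)).liftBaseChange _

lemma endFiberMap_tmul_germ (E : X.Modules) (x : X) (U : X.Opens) (hx : x ∈ U)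
    (c c' : IsLocalRing.ResidueField (X.presheaf.stalk x)) (φ : endSections E U) (s : Γ(E, U)) :
    endFiberMap E x (c ⊗ₜ (endSheaf E).presheaf.germ U x hx φ) (c' ⊗ₜ E.presheaf.germ U x hx s) =
      (c * c') ⊗ₜ E.presheaf.germ U x hx (φ.1 ⟨U, le_rfl⟩ s) := by
  have h1 : endStalkMap E x ((endSheaf E).presheaf.germ U x hx φ) = endGerm E x U hx φ :=
    endStalkHom_germ E x U hx φ
  have h2 := endGerm_germ_of_le E x U hx φ U hx le_rfl s
  simp [endFiberMap, h1, h2, TensorProduct.smul_tmul']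

/-! ### Cartan subalgebras -/

/-- A subspace `A ⊆ End(V)`, with `V` a vector space of finite dimension `d`, is a Cartan
subalgebra if `dim A = d` and some basis of `V` puts all elements of `A` in diagonal form.
(Then `A` consists of all endomorphisms that are diagonal in that basis, so it is automatically
a Lie subalgebra. The existence of the basis forces `V` to be finite-dimensional.) -/
def IsCartanSubalgebra {K V : Type*} [Field K] [AddCommGroup V] [Module K V]
    (A : Submodule K (Module.End K V)) : Prop :=
  Module.finrank K A = Module.finrank K V ∧
    ∃ (n : ℕ) (b : Module.Basis (Fin n) K V),
      ∀ a ∈ A, (LinearMap.toMatrix b b a).IsDiag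

/-! ### Vector bundles, projective varieties, coverings -/

/-- `E` is a vector bundle of rank `d`: it is locally isomorphic to `𝒪^d`. -/
def IsVectorBundle (d : ℕ) (E : X.Modules) : Prop :=
  ∀ x : X, ∃ U : X.Opens, x ∈ U ∧ Nonempty (E.restrict U.ι ≅
    SheafOfModules.free (R := (U : Scheme.{u}).ringCatSheaf) (ULift.{u} (Fin d)))

/-- The image under `α : E → End(E)` of the fibre of `E` at `x`, as a subspace of `End(E(x))`. -/
def fiberImage {E : X.Modules} (α : E ⟶ endSheaf E) (x : X) :
    Submodule (IsLocalRing.ResidueField (X.presheaf.stalk x))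
      (Module.End (IsLocalRing.ResidueField (X.presheaf.stalk x)) (Fiber E x)) :=
  LinearMap.range ((endFiberMap E x).comp (fiberMap α x))

/-- The direct image `f_* 𝒪_Y` as a sheaf of `𝒪_X`-modules. -/
def directImageStructureSheaf {Y : Scheme.{u}} (f : Y ⟶ X) : X.Modules :=
  (Scheme.Modules.pushforward f).obj (SheafOfModules.unit Y.ringCatSheaf)

/-- Étale coverings: finite étale morphisms. -/
structure IsEtaleCovering {Y : Scheme.{u}} (f : Y ⟶ X) : Prop where
  isFinite : IsFinite f
  etale : Etale f

section Field

variable {k : Type u} [Field k]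

attribute [local instance] MvPolynomial.gradedAlgebra in
variable (k) in
/-- Projective `n`-space over `k`: `Proj k[x_0, …, x_n]`. -/
def projectiveSpace (n : ℕ) : Scheme.{u} :=
  Proj (MvPolynomial.homogeneousSubmodule (Fin (n + 1)) k)

attribute [local instance] MvPolynomial.gradedAlgebra in
variable (k) in
/-- The structure morphism of projective space. -/
def projectiveSpaceToSpec (n : ℕ) : projectiveSpace k n ⟶ Spec (.of k) :=
  Proj.toSpecZero (MvPolynomial.homogeneousSubmodule (Fin (n + 1)) k) ≫
    Spec.map (CommRingCat.ofHom
      (algebraMap k (MvPolynomial.homogeneousSubmodule (Fin (n + 1)) k 0)))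

/-- `p : X → Spec k` makes `X` an irreducible projective variety over `k`: `X` is integral and
isomorphic over `k` to a closed subscheme of a projective space. -/
structure IsIrreducibleProjectiveVariety (p : X ⟶ Spec (.of k)) : Prop where
  isIntegral : IsIntegral X
  isProjective : ∃ (n : ℕ) (i : X ⟶ projectiveSpace k n),
    IsClosedImmersion i ∧ i ≫ projectiveSpaceToSpec k n = p

/-- The global sections `H⁰(X, E)` of a sheaf of modules on a `k`-scheme `p : X → Spec k`. -/
def H0 (_p : X ⟶ Spec (.of k)) (E : X.Modules) : Type u := Γ(E, ⊤)

instance (p : X ⟶ Spec (.of k)) (E : X.Modules) : AddCommGroup (H0 p E) :=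
  inferInstanceAs (AddCommGroup Γ(E, ⊤))

/-- `H⁰(X, E)` is a `k`-vector space through `k → H⁰(X, 𝒪_X)`. -/
instance (p : X ⟶ Spec (.of k)) (E : X.Modules) : Module k (H0 p E) :=
  Module.compHom Γ(E, ⊤) ((Scheme.ΓSpecIso (.of k)).inv ≫ p.appTop).hom

end Field

end CartanBundle

end

/-! From a covering to `α`: an isomorphism of `E` with `f_* 𝒪_Y` turns `E` into a sheaf of
commutative algebras, and `α` is multiplication (`AlgebraData.mulHom`). It is injective on fibres
because the algebra has a unit. At a closed point `x` the residue field is `k`, which is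
algebraically closed, so the fibre is an étale algebra over it, hence a product of copies of it. In
the basis of primitive idempotents multiplication is diagonal, and the dimension is right because
the action is faithful (`isCartanSubalgebra_range_of_mul`).

From `α` to a covering: by counting dimensions, a Cartan subalgebra consists of all matrices
diagonal in some basis, so it is a commutative unital algebra spanned by idempotents. The task is to
spread this out from closed points. Since `X` is reduced and Jacobson, sections of `E` and of
`End(E)` are determined by their values at closed points. Since `α` is injective on fibres at closed
points, in a frame it has a left inverse near each of them. Hence an endomorphism whose value at
every closed point lies in the Cartan subalgebra comes from a unique section of `E`
(`IsCartan.exists_action_eq`). Applied to the identity and to products, this makes `E` a sheaf of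
commutative algebras. It is quasi-coherent because `E` is locally free, so it has a relative
spectrum `Y`, affine over `X`, with `f_* 𝒪_Y ≅ E`. Over an affine open set with a frame the algebra
is finite free. Modulo each maximal ideal it is spanned by idempotents, and a derivation is
controlled on idempotents, so Nakayama kills the differentials
(`formallyUnramified_of_span_idempotent`). Finite, flat and unramified give finite étale.

Counting components: `Y` is reduced, and it is proper over `k`, so its global functions are integral
over `k`. The values of such a function are roots of one polynomial over `k`, hence locally
constant. There are finitely many components, because `f` is open and closed with finite fibres over
a connected base. Therefore `H⁰(X, E) = Γ(Y, 𝒪_Y)` is the space of functions from the set of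
components to `k`. -/

noncomputable section
namespace CartanBundle

variable {X : Scheme.{u}}

/-! ### Frames -/

/-- A family of sections of `E` over `U` is a frame if over each `V ⊆ U` it is a basis of
the sections of `E`. -/
def IsFrame {d : ℕ} (E : X.Modules) (U : X.Opens) (e : Fin d → Γ(E, U)) : Prop :=
  ∀ (V : X.Opens) (h : V ≤ U), Function.Bijective
    fun c : Fin d → Γ(X, V) ↦ ∑ i, c i • E.presheaf.map (homOfLE h).op (e i)

lemma map_sum_smul (E : X.Modules) {ι : Type*} (s : Finset ι) {U V : X.Opens} (h : V ≤ U)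
    (c : ι → Γ(X, U)) (e : ι → Γ(E, U)) :
    E.presheaf.map (homOfLE h).op (∑ i ∈ s, c i • e i) =
      ∑ i ∈ s, X.presheaf.map (homOfLE h).op (c i) • E.presheaf.map (homOfLE h).op (e i) := by
  rw [map_sum]
  exact Finset.sum_congr rfl fun i _ ↦ Scheme.Modules.map_smul E (homOfLE h) _ _

lemma mmap_self (E : X.Modules) {U : X.Opens} (s : Γ(E, U)) :
    E.presheaf.map (homOfLE le_rfl).op s = s := by
  have : (homOfLE (le_refl U)).op = 𝟙 _ := rfl
  rw [this, E.presheaf.map_id]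
  rfl

lemma IsFrame.restrict {d : ℕ} {E : X.Modules} {U V : X.Opens} {e : Fin d → Γ(E, U)}
    (he : IsFrame E U e) (h : V ≤ U) :
    IsFrame E V fun i ↦ E.presheaf.map (homOfLE h).op (e i) := by
  intro W hW
  simpa only [mmap_comp] using he W (hW.trans h)

lemma Hom.app_map {M N : X.Modules} (φ : M ⟶ N) {U V : X.Opens} (h : V ≤ U) (s : Γ(M, U)) :
    φ.app V (M.presheaf.map (homOfLE h).op s) = N.presheaf.map (homOfLE h).op (φ.app U s) :=
  ConcreteCategory.congr_hom (φ.mapPresheaf.naturality (homOfLE h).op) s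

lemma IsFrame.of_iso {d : ℕ} {M N : X.Modules} (φ : M ≅ N) {U : X.Opens} {e : Fin d → Γ(M, U)}
    (he : IsFrame M U e) : IsFrame N U fun i ↦ φ.hom.app U (e i) := by
  intro V h
  have hb : Function.Bijective (φ.hom.app V) := ConcreteCategory.bijective_of_isIso _
  convert hb.comp (he V h) using 1
  ext c
  simp only [Function.comp_apply, map_sum, Scheme.Modules.Hom.app_smul, Hom.app_map]

/-! ### Sections of free sheaves of modules -/

section Free

open SheafOfModules in
/-- The projection of a free sheaf of modules to a factor. -/
def freeProj {C : Type*} [Category* C] {J : GrothendieckTopology C} (R : Sheaf J RingCat.{u})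
    [HasSheafify J AddCommGrpCat.{u}] [J.WEqualsLocallyBijective AddCommGrpCat.{u}]
    (I : Type u) [DecidableEq I] (i : I) : free (R := R) I ⟶ unit R :=
  Limits.Cofan.IsColimit.desc (isColimitFreeCofan I) fun j ↦ if j = i then 𝟙 _ else 0

open SheafOfModules in
lemma ιFree_freeProj {C : Type*} [Category* C] {J : GrothendieckTopology C}
    (R : Sheaf J RingCat.{u})
    [HasSheafify J AddCommGrpCat.{u}] [J.WEqualsLocallyBijective AddCommGrpCat.{u}]
    (I : Type u) [DecidableEq I] (i j : I) :
    ιFree (R := R) j ≫ freeProj R I i = if j = i then 𝟙 _ else 0 :=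
  Limits.Cofan.IsColimit.fac _ _ _

-- For finite `I` the coproduct is a biproduct. This relation and `ιFree_freeProj` survive passage
-- to sections, so the sections of a free module can be computed without unfolding its construction
-- as a colimit of sheaves.
open SheafOfModules in
lemma sum_freeProj_ιFree {C : Type*} [Category* C] {J : GrothendieckTopology C}
    (R : Sheaf J RingCat.{u}) [HasSheafify J AddCommGrpCat.{u}]
    [J.WEqualsLocallyBijective AddCommGrpCat.{u}] (I : Type u) [DecidableEq I] [Fintype I] :
    ∑ i, freeProj R I i ≫ ιFree (R := R) i = 𝟙 _ := by
  refine Limits.Cofan.IsColimit.hom_ext (isColimitFreeCofan I) _ _ fun j ↦ ?_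
  change ιFree j ≫ (∑ i, freeProj R I i ≫ ιFree i : free I ⟶ free I) = ιFree j ≫ 𝟙 (free I)
  rw [Preadditive.comp_sum]
  simp_rw [← Category.assoc, ιFree_freeProj]
  rw [Finset.sum_eq_single j]
  · simp
  · intro b _ hb
    simp [hb.symm]
  · simp

variable (Z : Scheme.{u}) (d : ℕ)

/-- The frame is the image of `1` under the inclusions. Over each open set the biproduct relations
show that the projections compute the coordinates of a section. -/
lemma exists_isFrame_free : ∃ e : Fin d → Γ(((SheafOfModules.free (R := Z.ringCatSheaf)
    (ULift.{u} (Fin d)) : SheafOfModules Z.ringCatSheaf) : Z.Modules), ⊤), IsFrame _ ⊤ e := by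
  let N : Z.Modules := SheafOfModules.free (R := Z.ringCatSheaf) (ULift.{u} (Fin d))
  let O : Z.Modules := SheafOfModules.unit Z.ringCatSheaf
  let ι (i : Fin d) : O ⟶ N := SheafOfModules.ιFree (R := Z.ringCatSheaf) ⟨i⟩
  let π (i : Fin d) : N ⟶ O := freeProj Z.ringCatSheaf _ ⟨i⟩
  have h1 (i j : Fin d) : ι j ≫ π i = if j = i then 𝟙 _ else 0 := by
    refine (ιFree_freeProj Z.ringCatSheaf _ _ _).trans ?_
    simp only [ULift.up_inj]
    rfl
  have h2 : ∑ i, π i ≫ ι i = 𝟙 N :=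
    (Equiv.sum_comp Equiv.ulift.symm fun i : ULift.{u} (Fin d) ↦
      freeProj Z.ringCatSheaf _ i ≫ SheafOfModules.ιFree (R := Z.ringCatSheaf) i).trans
        (sum_freeProj_ιFree Z.ringCatSheaf _)
  let one (V : Z.Opens) : Γ(O, V) := (1 : Γ(Z, V))
  have hone (V : Z.Opens) (r : Γ(Z, V)) : (show Γ(O, V) from r) = r • one V :=
    (mul_one r).symm
  have hres (V : Z.Opens) : O.presheaf.map (homOfLE le_top).op (one ⊤) = one V :=
    map_one (Z.presheaf.map (homOfLE (le_top : V ≤ ⊤)).op).hom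
  have hsum (V : Z.Opens) (s : Γ(N, V)) : ∑ i, (ι i).app V ((π i).app V s) = s := by
    have key (t : Finset (Fin d)) : (∑ i ∈ t, π i ≫ ι i).app V s =
        ∑ i ∈ t, (ι i).app V ((π i).app V s) := by
      induction t using Finset.induction_on with
      | empty => simp
      | insert a t ha ih => simp [Finset.sum_insert ha, ih]
    exact (key _).symm.trans (by rw [h2]; rfl)
  have hδ (V : Z.Opens) (i j : Fin d) (x : Γ(O, V)) :
      (π i).app V ((ι j).app V x) = if j = i then x else 0 := by
    have : (ι j ≫ π i).app V x = (π i).app V ((ι j).app V x) := rfl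
    rw [← this, h1]
    split_ifs <;> simp
  have hδ' (V : Z.Opens) (i : Fin d) (x : Fin d → Γ(O, V)) :
      (π i).app V (∑ j, (ι j).app V (x j)) = x i := by
    rw [map_sum, Finset.sum_congr rfl fun j _ ↦ hδ V i j (x j), Finset.sum_ite_eq' Finset.univ i x]
    exact if_pos (Finset.mem_univ i)
  refine ⟨fun i ↦ (ι i).app ⊤ (one ⊤), fun V h ↦ ?_⟩
  have hfun (c : Fin d → Γ(Z, V)) :
      ∑ i, c i • N.presheaf.map (homOfLE h).op ((ι i).app ⊤ (one ⊤)) =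
      ∑ i, (ι i).app V (show Γ(O, V) from c i) := by
    refine Finset.sum_congr rfl fun i _ ↦ ?_
    rw [← Hom.app_map, hres, ← Scheme.Modules.Hom.app_smul, ← hone]
  refine ⟨fun c c' hc ↦ funext fun i ↦ ?_, fun s ↦ ⟨fun i ↦ (π i).app V s, ?_⟩⟩
  · have := congrArg ((π i).app V) ((hfun c).symm.trans (hc.trans (hfun c')))
    exact (hδ' V i c).symm.trans (this.trans (hδ' V i c'))
  · exact (hfun _).trans (hsum V s)

end Free

lemma IsVectorBundle.exists_isFrame {d : ℕ} {E : X.Modules} (hE : IsVectorBundle d E) (x : X) :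
    ∃ (U : X.Opens) (_ : x ∈ U) (e : Fin d → Γ(E, U)), IsFrame E U e := by
  obtain ⟨U, hx, ⟨φ⟩⟩ := hE x
  obtain ⟨e, he⟩ := exists_isFrame_free U d
  have hf := he.of_iso φ.symm
  refine ⟨U.ι ''ᵁ ⊤, by simpa using hx, fun i ↦ φ.inv.app ⊤ (e i), ?_⟩
  intro V h
  obtain ⟨V, rfl⟩ : ∃ V' : U.toScheme.Opens, U.ι ''ᵁ V' = V := by
    refine ⟨U.ι ⁻¹ᵁ V, ?_⟩
    rw [Scheme.Hom.image_preimage_eq_opensRange_inf]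
    simpa using h
  refine (congrArg (Function.Bijective (α := Fin d → Γ(X, U.ι ''ᵁ V)) (β := Γ(E, U.ι ''ᵁ V)))
    (funext fun c ↦ ?_)).mp (hf V le_top)
  refine Finset.sum_congr rfl fun i _ ↦ ?_
  -- Scalars act on the restriction of `E` to `U` through `U.ι.appIso`, which for an open subscheme
  -- is the identity.
  have : c i = (U.ι.appIso V).inv (c i) := by rw [Scheme.Opens.ι_appIso]; rfl
  exact congrArg (· • E.presheaf.map (homOfLE h).op (φ.inv.app ⊤ (e i))) this.symm

/-- The basis of the sections given by a frame. -/
def IsFrame.basis {d : ℕ} {E : X.Modules} {U : X.Opens} {e : Fin d → Γ(E, U)}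
    (he : IsFrame E U e) {V : X.Opens} (h : V ≤ U) : Module.Basis (Fin d) Γ(X, V) Γ(E, V) :=
  .ofEquivFun (LinearEquiv.ofBijective (Fintype.linearCombination Γ(X, V)
    fun i ↦ E.presheaf.map (homOfLE h).op (e i)) (he V h)).symm

lemma IsFrame.basis_apply {d : ℕ} {E : X.Modules} {U : X.Opens} {e : Fin d → Γ(E, U)}
    (he : IsFrame E U e) {V : X.Opens} (h : V ≤ U) (i : Fin d) :
    he.basis h i = E.presheaf.map (homOfLE h).op (e i) := by
  rw [IsFrame.basis, Module.Basis.coe_ofEquivFun]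
  refine (Fintype.linearCombination_apply_single _ _ _ _).trans (one_smul _ _)

lemma IsFrame.exists_coord {d : ℕ} {E : X.Modules} {U : X.Opens} {e : Fin d → Γ(E, U)}
    (he : IsFrame E U e) (s : Γ(E, U)) : ∃ c : Fin d → Γ(X, U), s = ∑ i, c i • e i := by
  obtain ⟨c, hc⟩ := (he U le_rfl).2 s
  exact ⟨c, by simpa only [mmap_self] using hc.symm⟩

/-! ### Fibres -/

lemma germ_sum_smul (E : X.Modules) {ι : Type*} (s : Finset ι) {x : X} {U : X.Opens} (hx : x ∈ U)
    (c : ι → Γ(X, U)) (e : ι → Γ(E, U)) :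
    E.presheaf.germ U x hx (∑ i ∈ s, c i • e i) =
      ∑ i ∈ s, X.presheaf.germ U x hx (c i) • E.presheaf.germ U x hx (e i) := by
  rw [map_sum]
  exact Finset.sum_congr rfl fun i _ ↦ germ_smul E x U hx _ _

lemma exists_common_germ (x : X) {ι : Type*} [Finite ι] (U : X.Opens) (hx : x ∈ U)
    (r : ι → X.presheaf.stalk x) :
    ∃ (V : X.Opens) (hV : x ∈ V) (_ : V ≤ U) (c : ι → Γ(X, V)),
      ∀ i, X.presheaf.germ V x hV (c i) = r i := by
  choose W hW c hc using fun i ↦ TopCat.Presheaf.exists_germ_eq X.presheaf (r i)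
  let V : X.Opens := ⟨U ∩ ⋂ i, W i, U.2.inter (isOpen_iInter_of_finite fun i ↦ (W i).2)⟩
  have hVW (i) : V ≤ W i := fun y hy ↦ Set.mem_iInter.mp hy.2 i
  refine ⟨V, ⟨hx, Set.mem_iInter.mpr hW⟩, fun y hy ↦ hy.1,
    fun i ↦ X.presheaf.map (homOfLE (hVW i)).op (c i), fun i ↦ ?_⟩
  rw [← hc]
  exact TopCat.Presheaf.germ_res_apply X.presheaf (homOfLE (hVW i)) x _ (c i)

/-- A linear relation between germs already holds on some smaller open set, and there the restricted
frame is still a basis. Likewise each germ is represented by a section that has coordinates. -/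
lemma IsFrame.stalk_bijective {d : ℕ} {E : X.Modules} {U : X.Opens} {e : Fin d → Γ(E, U)}
    (he : IsFrame E U e) (x : X) (hx : x ∈ U) :
    Function.Bijective (Fintype.linearCombination (X.presheaf.stalk x)
      fun i ↦ E.presheaf.germ U x hx (e i)) := by
  constructor
  · rw [injective_iff_map_eq_zero]
    intro r hr
    obtain ⟨V, hV, h, c, hc⟩ := exists_common_germ x U hx r
    have h1 : E.presheaf.germ V x hV (∑ i, c i • E.presheaf.map (homOfLE h).op (e i)) =
        E.presheaf.germ V x hV 0 := by
      rw [germ_sum_smul, map_zero, ← hr, Fintype.linearCombination_apply]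
      simp only [hc, germ_restrict]
    obtain ⟨W, hW, i, j, h2⟩ := TopCat.Presheaf.germ_eq E.presheaf x hV hV _ _ h1
    obtain rfl : i = j := Subsingleton.elim _ _
    replace h2 : E.presheaf.map (homOfLE i.le).op _ = E.presheaf.map (homOfLE i.le).op 0 := h2
    rw [map_sum_smul, map_zero] at h2
    simp only [mmap_comp] at h2
    have h3 := (he W (i.le.trans h)).1 (a₁ := fun k ↦ X.presheaf.map (homOfLE i.le).op (c k))
      (a₂ := 0) (h2.trans (by simp))
    ext k
    rw [← hc]
    have h4 : X.presheaf.map (homOfLE i.le).op (c k) = 0 := congrFun h3 k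
    have h5 := TopCat.Presheaf.germ_res_apply X.presheaf (homOfLE i.le) x hW (c k)
    rw [← h5, h4, map_zero]
    rfl
  · intro m
    obtain ⟨V, hV, hVU, s, rfl⟩ := exists_germ_le E U hx m
    obtain ⟨c, rfl⟩ := (he.restrict hVU).exists_coord s
    refine ⟨fun i ↦ X.presheaf.germ V x hV (c i), ?_⟩
    rw [Fintype.linearCombination_apply, germ_sum_smul]
    simp only [germ_restrict]

/-- A frame gives a basis of the stalks. -/
def IsFrame.stalkBasis {d : ℕ} {E : X.Modules} {U : X.Opens} {e : Fin d → Γ(E, U)}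
    (he : IsFrame E U e) (x : X) (hx : x ∈ U) :
    Module.Basis (Fin d) (X.presheaf.stalk x) (E.presheaf.stalk x) :=
  .ofEquivFun (LinearEquiv.ofBijective _ (he.stalk_bijective x hx)).symm

lemma IsFrame.stalkBasis_apply {d : ℕ} {E : X.Modules} {U : X.Opens} {e : Fin d → Γ(E, U)}
    (he : IsFrame E U e) (x : X) (hx : x ∈ U) (i : Fin d) :
    he.stalkBasis x hx i = E.presheaf.germ U x hx (e i) := by
  rw [IsFrame.stalkBasis, Module.Basis.coe_ofEquivFun]
  refine (Fintype.linearCombination_apply_single _ _ _ _).trans (one_smul _ _)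

/-- The value of a section at a point, in the fibre. -/
def value (E : X.Modules) (x : X) (U : X.Opens) (hx : x ∈ U) (s : Γ(E, U)) : Fiber E x :=
  1 ⊗ₜ E.presheaf.germ U x hx s

/-- A frame gives a basis of the fibres. -/
def IsFrame.fiberBasis {d : ℕ} {E : X.Modules} {U : X.Opens} {e : Fin d → Γ(E, U)}
    (he : IsFrame E U e) (x : X) (hx : x ∈ U) :
    Module.Basis (Fin d) (IsLocalRing.ResidueField (X.presheaf.stalk x)) (Fiber E x) :=
  (he.stalkBasis x hx).baseChange _

lemma IsFrame.fiberBasis_apply {d : ℕ} {E : X.Modules} {U : X.Opens} {e : Fin d → Γ(E, U)}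
    (he : IsFrame E U e) (x : X) (hx : x ∈ U) (i : Fin d) :
    he.fiberBasis x hx i = value E x U hx (e i) := by
  rw [IsFrame.fiberBasis, Module.Basis.baseChange_apply, he.stalkBasis_apply, value]

/-! ### Values at points -/

/-- The value of a function at a point, in the residue field. -/
def evalAt (x : X) (U : X.Opens) (hx : x ∈ U) :
    Γ(X, U) →+* IsLocalRing.ResidueField (X.presheaf.stalk x) :=
  (IsLocalRing.residue (X.presheaf.stalk x)).comp (X.presheaf.germ U x hx).hom

lemma evalAt_apply (x : X) (U : X.Opens) (hx : x ∈ U) (r : Γ(X, U)) :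
    evalAt x U hx r = IsLocalRing.residue (X.presheaf.stalk x) (X.presheaf.germ U x hx r) := rfl

lemma evalAt_restrict {x : X} {U V : X.Opens} (h : V ≤ U) (hx : x ∈ V) (r : Γ(X, U)) :
    evalAt x V hx (X.presheaf.map (homOfLE h).op r) = evalAt x U (h hx) r :=
  congrArg (IsLocalRing.residue _) (TopCat.Presheaf.germ_res_apply X.presheaf (homOfLE h) x hx r)

lemma evalAt_ne_zero_iff (x : X) (U : X.Opens) (hx : x ∈ U) (r : Γ(X, U)) :
    evalAt x U hx r ≠ 0 ↔ x ∈ X.basicOpen r := by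
  rw [evalAt_apply, IsLocalRing.residue_ne_zero_iff_isUnit]
  exact (Scheme.mem_basicOpen X r x hx).symm

lemma value_restrict (E : X.Modules) {x : X} {U V : X.Opens} (h : V ≤ U) (hx : x ∈ V)
    (s : Γ(E, U)) : value E x V hx (E.presheaf.map (homOfLE h).op s) = value E x U (h hx) s :=
  congrArg (fun t ↦ (1 : IsLocalRing.ResidueField (X.presheaf.stalk x)) ⊗ₜ t)
    (germ_restrict E h hx s)

lemma value_add (E : X.Modules) (x : X) (U : X.Opens) (hx : x ∈ U) (s t : Γ(E, U)) :
    value E x U hx (s + t) = value E x U hx s + value E x U hx t := by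
  rw [value, map_add, TensorProduct.tmul_add]
  rfl

lemma value_zero (E : X.Modules) (x : X) (U : X.Opens) (hx : x ∈ U) :
    value E x U hx 0 = 0 := by
  rw [value, map_zero, TensorProduct.tmul_zero]

lemma value_smul (E : X.Modules) (x : X) (U : X.Opens) (hx : x ∈ U) (r : Γ(X, U)) (s : Γ(E, U)) :
    value E x U hx (r • s) = evalAt x U hx r • value E x U hx s := by
  rw [value, germ_smul, TensorProduct.tmul_smul, TensorProduct.smul_tmul', value,
    TensorProduct.smul_tmul', evalAt_apply, smul_eq_mul, mul_one, Algebra.smul_def, mul_one]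
  rfl

lemma value_sum_smul (E : X.Modules) (x : X) (U : X.Opens) (hx : x ∈ U) {ι : Type*} (S : Finset ι)
    (c : ι → Γ(X, U)) (s : ι → Γ(E, U)) :
    value E x U hx (∑ i ∈ S, c i • s i) = ∑ i ∈ S, evalAt x U hx (c i) • value E x U hx (s i) := by
  classical
  induction S using Finset.induction_on with
  | empty => simp [value_zero]
  | insert a t ha ih => rw [Finset.sum_insert ha, Finset.sum_insert ha, value_add, value_smul, ih]

/-- Each `c ⊗ m` is a multiple of `1 ⊗ m`, and `m` is a germ of a section over some `V ≤ U`. So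
linear statements about a fibre need only be tested on values of sections near `x`. -/
lemma fiber_induction (E : X.Modules) (x : X) (U : X.Opens) (hx : x ∈ U)
    {p : Fiber E x → Prop} (h0 : p 0) (hadd : ∀ v w, p v → p w → p (v + w))
    (hsmul : ∀ (c : IsLocalRing.ResidueField (X.presheaf.stalk x)) v, p v → p (c • v))
    (h : ∀ (V : X.Opens) (hV : x ∈ V) (_ : V ≤ U) (s : Γ(E, V)), p (value E x V hV s)) (v) :
    p v := by
  induction v using TensorProduct.induction_on with
  | zero => exact h0
  | add v w hv hw => exact hadd v w hv hw
  | tmul c m =>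
    obtain ⟨V, hV, hVU, s, rfl⟩ := exists_germ_le E U hx m
    have := hsmul c _ (h V hV hVU s)
    rwa [value, TensorProduct.smul_tmul', smul_eq_mul, mul_one] at this

/-- The value of an endomorphism of `E|_U` at a point. -/
def endEval (E : X.Modules) (x : X) (U : X.Opens) (hx : x ∈ U) (φ : endSections E U) :
    Module.End (IsLocalRing.ResidueField (X.presheaf.stalk x)) (Fiber E x) :=
  (endGerm E x U hx φ).baseChange _

lemma endEval_value (E : X.Modules) (x : X) (U : X.Opens) (hx : x ∈ U) (φ : endSections E U)
    (V : X.Opens) (hV : x ∈ V) (hVU : V ≤ U) (s : Γ(E, V)) :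
    endEval E x U hx φ (value E x V hV s) = value E x V hV (φ.1 ⟨V, hVU⟩ s) := by
  rw [endEval, value, LinearMap.baseChange_tmul, endGerm_germ_of_le E x U hx φ V hV hVU, value]

lemma endFiberMap_value (E : X.Modules) (x : X) (U : X.Opens) (hx : x ∈ U) (φ : endSections E U) :
    endFiberMap E x (value (endSheaf E) x U hx φ) = endEval E x U hx φ := by
  have h1 : endStalkMap E x ((endSheaf E).presheaf.germ U x hx φ) = endGerm E x U hx φ :=
    endStalkHom_germ E x U hx φ
  simp [endFiberMap, value, h1, endEval]

lemma fiberMap_value {M N : X.Modules} (φ : M ⟶ N) (x : X) (U : X.Opens) (hx : x ∈ U)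
    (s : Γ(M, U)) : fiberMap φ x (value M x U hx s) = value N x U hx (φ.app U s) := by
  have h1 : stalkMap φ x (M.presheaf.germ U x hx s) = N.presheaf.germ U x hx (φ.app U s) :=
    TopCat.Presheaf.stalkFunctor_map_germ_apply U x hx φ.mapPresheaf s
  rw [fiberMap, value, LinearMap.baseChange_tmul, h1, value]

/-- The map from the fibre of `E` to the endomorphisms of the fibre given by `α`. -/
def fiberAction {E : X.Modules} (α : E ⟶ endSheaf E) (x : X) :
    Fiber E x →ₗ[IsLocalRing.ResidueField (X.presheaf.stalk x)]
      Module.End (IsLocalRing.ResidueField (X.presheaf.stalk x)) (Fiber E x) :=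
  (endFiberMap E x).comp (fiberMap α x)

/-- The endomorphism of `E|_U` given by a section of `E` over `U`. -/
def action {E : X.Modules} (α : E ⟶ endSheaf E) (U : X.Opens) : Γ(E, U) →+ endSections E U :=
  (α.app U).hom

lemma action_smul {E : X.Modules} (α : E ⟶ endSheaf E) (U : X.Opens) (r : Γ(X, U)) (s : Γ(E, U)) :
    action α U (r • s) = r • action α U s :=
  Scheme.Modules.Hom.app_smul α r s

lemma action_restrict {E : X.Modules} (α : E ⟶ endSheaf E) {U V : X.Opens} (h : V ≤ U)
    (s : Γ(E, U)) : action α V (E.presheaf.map (homOfLE h).op s) = endRestrict E h (action α U s) :=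
  Hom.app_map α h s

lemma fiberAction_value {E : X.Modules} (α : E ⟶ endSheaf E) (x : X) (U : X.Opens) (hx : x ∈ U)
    (s : Γ(E, U)) : fiberAction α x (value E x U hx s) = endEval E x U hx (action α U s) := by
  rw [fiberAction, LinearMap.comp_apply, fiberMap_value]
  exact endFiberMap_value E x U hx _

lemma end_fiber_ext (E : X.Modules) (x : X) (U : X.Opens) (hx : x ∈ U)
    {f g : Module.End (IsLocalRing.ResidueField (X.presheaf.stalk x)) (Fiber E x)}
    (h : ∀ (V : X.Opens) (hV : x ∈ V) (_ : V ≤ U) (s : Γ(E, V)),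
      f (value E x V hV s) = g (value E x V hV s)) : f = g :=
  LinearMap.ext fun v ↦ fiber_induction E x U hx (p := fun v ↦ f v = g v) (by simp)
    (fun v w hv hw ↦ by rw [map_add, hv, hw, map_add])
    (fun c v hv ↦ by rw [map_smul, hv, map_smul]) h v

lemma endEval_restrict (E : X.Modules) {x : X} {U V : X.Opens} (h : V ≤ U) (hx : x ∈ V)
    (φ : endSections E U) : endEval E x V hx (endRestrict E h φ) = endEval E x U (h hx) φ :=
  end_fiber_ext E x V hx fun W hW hWV s ↦ by
    rw [endEval_value _ _ _ _ _ W hW hWV, endEval_value _ _ _ _ _ W hW (hWV.trans h)]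
    rfl

lemma endEval_sub (E : X.Modules) (x : X) (U : X.Opens) (hx : x ∈ U) (φ ψ : endSections E U) :
    endEval E x U hx (φ - ψ) = endEval E x U hx φ - endEval E x U hx ψ :=
  end_fiber_ext E x U hx fun V hV hVU s ↦ by
    rw [LinearMap.sub_apply, endEval_value _ _ _ _ _ V hV hVU, endEval_value _ _ _ _ _ V hV hVU,
      endEval_value _ _ _ _ _ V hV hVU]
    refine eq_sub_of_add_eq ?_
    rw [← value_add]
    exact congrArg _ (sub_add_cancel (φ.1 ⟨V, hVU⟩ s) (ψ.1 ⟨V, hVU⟩ s))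

/-- Composition of endomorphisms of `E|_U`. -/
instance (E : X.Modules) (U : X.Opens) : Mul (endSections E U) where
  mul φ ψ := ⟨φ.1 * ψ.1, fun V W h s ↦
    (φ.2 V W h (ψ.1 V s)).trans (congrArg (φ.1 W) (ψ.2 V W h s))⟩

/-- The identity of `E|_U`. -/
instance (E : X.Modules) (U : X.Opens) : One (endSections E U) where
  one := ⟨1, fun _ _ _ _ ↦ rfl⟩

lemma endEval_mul (E : X.Modules) (x : X) (U : X.Opens) (hx : x ∈ U) (φ ψ : endSections E U) :
    endEval E x U hx (φ * ψ) = endEval E x U hx φ * endEval E x U hx ψ :=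
  end_fiber_ext E x U hx fun V hV hVU s ↦ by
    rw [Module.End.mul_apply, endEval_value _ _ _ _ _ V hV hVU, endEval_value _ _ _ _ _ V hV hVU,
      endEval_value _ _ _ _ _ V hV hVU]
    rfl

lemma endEval_one (E : X.Modules) (x : X) (U : X.Opens) (hx : x ∈ U) :
    endEval E x U hx 1 = 1 :=
  end_fiber_ext E x U hx fun V hV hVU s ↦ endEval_value _ _ _ _ _ V hV hVU s

/-- This lets linear algebra in the fibres be carried out by matrices of functions. -/
lemma IsFrame.toMatrix_endEval {d : ℕ} {E : X.Modules} {U : X.Opens} {e : Fin d → Γ(E, U)}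
    (he : IsFrame E U e) (x : X) (hx : x ∈ U) (φ : endSections E U) :
    LinearMap.toMatrix (he.fiberBasis x hx) (he.fiberBasis x hx) (endEval E x U hx φ) =
      (LinearMap.toMatrix (he.basis le_rfl) (he.basis le_rfl) (φ.1 ⟨U, le_rfl⟩)).map
        (evalAt x U hx) := by
  ext a b
  rw [LinearMap.toMatrix_apply, Matrix.map_apply, LinearMap.toMatrix_apply, he.fiberBasis_apply,
    endEval_value _ _ _ _ _ U hx le_rfl, he.basis_apply, mmap_self]
  conv_lhs => rw [← (he.basis le_rfl).sum_repr (φ.1 ⟨U, le_rfl⟩ (e b)), value_sum_smul]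
  simp_rw [he.basis_apply, mmap_self, ← he.fiberBasis_apply x hx]
  rw [Module.Basis.repr_sum_self]

/-! ### Detection on closed points -/

/-- Otherwise `U \ W` is a nonempty locally closed set, and in a Jacobson space it contains a closed
point. -/
lemma le_of_closedPoints [JacobsonSpace X] {U W : X.Opens}
    (h : ∀ x ∈ U, IsClosed ({x} : Set X) → x ∈ W) : U ≤ W := by
  by_contra hUW
  obtain ⟨y, hy, hy'⟩ := Set.not_subset.mp hUW
  obtain ⟨z, ⟨hz, hz'⟩, hz''⟩ := nonempty_inter_closedPoints
    (Z := (U : Set X) ∩ (W : Set X)ᶜ) ⟨y, hy, hy'⟩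
    (U.2.isLocallyClosed.inter W.2.isClosed_compl.isLocallyClosed)
  exact hz' (h z hz hz'')

lemma section_ext_of_closedPoints [JacobsonSpace X] (E : X.Modules) {U : X.Opens} (s t : Γ(E, U))
    (h : ∀ x ∈ U, IsClosed ({x} : Set X) → ∃ (V : X.Opens) (_ : x ∈ V) (hV : V ≤ U),
      E.presheaf.map (homOfLE hV).op s = E.presheaf.map (homOfLE hV).op t) : s = t := by
  choose V hx hV h' using h
  let W (p : {x // x ∈ U ∧ IsClosed ({x} : Set X)}) : X.Opens := V p.1 p.2.1 p.2.2
  refine section_ext E W ?_ s t fun p ↦ ?_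
  · exact le_of_closedPoints fun x hxU hxc ↦
      Opens.mem_iSup.mpr ⟨⟨x, hxU, hxc⟩, hx x hxU hxc⟩
  · have := congrArg (E.presheaf.map (homOfLE (inf_le_right : U ⊓ W p ≤ W p)).op)
      (h' p.1 p.2.1 p.2.2)
    rwa [mmap_comp, mmap_comp] at this

/-- The nonvanishing locus of `r` is open and contains no closed point, so it is empty. On a reduced
scheme this forces `r = 0`. -/
lemma function_eq_zero [JacobsonSpace X] [IsReduced X] {U : X.Opens} (r : Γ(X, U))
    (h : ∀ x (hx : x ∈ U), IsClosed ({x} : Set X) → evalAt x U hx r = 0) : r = 0 := by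
  rw [← basicOpen_eq_bot_iff, ← le_bot_iff]
  refine le_of_closedPoints fun x hx hc ↦ ?_
  exact ((evalAt_ne_zero_iff x U (X.basicOpen_le r hx) r).mpr hx (h x _ hc)).elim

/-- In a local frame the value of `s` has as coordinates the values of the coordinates of `s`, so
`function_eq_zero` applies to each of them. -/
lemma section_eq_zero [JacobsonSpace X] [IsReduced X] {d : ℕ} {E : X.Modules}
    (hE : IsVectorBundle d E) {U : X.Opens} (s : Γ(E, U))
    (h : ∀ x (hx : x ∈ U), IsClosed ({x} : Set X) → value E x U hx s = 0) : s = 0 := by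
  refine section_ext_of_closedPoints E s 0 fun x hx hc ↦ ?_
  obtain ⟨V, hxV, e, he⟩ := hE.exists_isFrame x
  refine ⟨U ⊓ V, ⟨hx, hxV⟩, inf_le_left, ?_⟩
  replace he := he.restrict (inf_le_right : U ⊓ V ≤ V)
  obtain ⟨c, hcs⟩ := he.exists_coord (E.presheaf.map (homOfLE (inf_le_left : U ⊓ V ≤ U)).op s)
  rw [hcs, map_zero]
  refine Finset.sum_eq_zero fun i _ ↦ ?_
  rw [function_eq_zero (c i), zero_smul]
  intro y hy hyc
  have h1 := h y hy.1 hyc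
  rw [← value_restrict E (inf_le_left : U ⊓ V ≤ U) hy, hcs, value_sum_smul] at h1
  simp_rw [← he.fiberBasis_apply y hy] at h1
  exact Fintype.linearIndependent_iff.mp (he.fiberBasis y hy).linearIndependent _ h1 i

lemma end_eq_zero [JacobsonSpace X] [IsReduced X] {d : ℕ} {E : X.Modules}
    (hE : IsVectorBundle d E) {U : X.Opens} (φ : endSections E U)
    (h : ∀ x (hx : x ∈ U), IsClosed ({x} : Set X) → endEval E x U hx φ = 0) : φ = 0 := by
  refine Subtype.ext (funext fun V ↦ LinearMap.ext fun s ↦ section_eq_zero hE _ fun x hx hc ↦ ?_)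
  rw [← endEval_value E x U (V.2 hx) φ V.1 hx V.2, h x (V.2 hx) hc, LinearMap.zero_apply]

lemma end_ext [JacobsonSpace X] [IsReduced X] {d : ℕ} {E : X.Modules}
    (hE : IsVectorBundle d E) {U : X.Opens} {φ ψ : endSections E U}
    (h : ∀ x (hx : x ∈ U), IsClosed ({x} : Set X) → endEval E x U hx φ = endEval E x U hx ψ) :
    φ = ψ :=
  sub_eq_zero.mp <| end_eq_zero hE (φ - ψ) fun x hx hc ↦
    (endEval_sub E x U hx φ ψ).trans (sub_eq_zero.mpr (h x hx hc))

/-! ### Cartan subalgebras -/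

section Cartan

variable {K V : Type*} [Field K] [AddCommGroup V] [Module K V]

/-- A Cartan subalgebra consists of all endomorphisms that are diagonal in some basis. -/
lemma IsCartanSubalgebra.exists_basis {A : Submodule K (Module.End K V)}
    (hA : IsCartanSubalgebra A) : ∃ (n : ℕ) (b : Module.Basis (Fin n) K V),
      ∀ a, a ∈ A ↔ (LinearMap.toMatrix b b a).IsDiag := by
  obtain ⟨hdim, n, b, hb⟩ := hA
  refine ⟨n, b, fun a ↦ ⟨hb a, fun ha ↦ ?_⟩⟩
  -- `D` parametrizes the diagonal endomorphisms. Its range contains `A` and has dimension `n = dim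
  -- V = dim A`, so the two coincide.
  let D : (Fin n → K) →ₗ[K] Module.End K V :=
    (LinearMap.toMatrix b b).symm.toLinearMap.comp (Matrix.diagonalLinearMap (Fin n) K K)
  have hD : Function.Injective D :=
    (LinearMap.toMatrix b b).symm.injective.comp Matrix.diagonal_injective
  have hmem (a) : (LinearMap.toMatrix b b a).IsDiag → a ∈ LinearMap.range D := fun h ↦ by
    refine ⟨(LinearMap.toMatrix b b a).diag, ?_⟩
    refine (LinearMap.toMatrix b b).injective ?_
    change LinearMap.toMatrix b b ((LinearMap.toMatrix b b).symm (Matrix.diagonal _)) = _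
    rw [LinearEquiv.apply_symm_apply]
    exact (Matrix.isDiag_iff_diagonal_diag _).mp h
  have hle : A ≤ LinearMap.range D := fun a ha ↦ hmem a (hb a ha)
  have : Module.Finite K V := .of_basis b
  have heq : A = LinearMap.range D := Submodule.eq_of_le_of_finrank_eq hle <| by
    rw [LinearMap.finrank_range_of_inj hD, hdim, Module.finrank_eq_card_basis b,
      Module.finrank_fintype_fun_eq_card]
  exact heq ▸ hmem a ha

lemma IsCartanSubalgebra.one_mem {A : Submodule K (Module.End K V)}
    (hA : IsCartanSubalgebra A) : 1 ∈ A := by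
  obtain ⟨n, b, hb⟩ := hA.exists_basis
  rw [hb, LinearMap.toMatrix_one]
  exact Matrix.isDiag_one

lemma IsCartanSubalgebra.mul_mem {A : Submodule K (Module.End K V)}
    (hA : IsCartanSubalgebra A) {a c : Module.End K V} (ha : a ∈ A) (hc : c ∈ A) : a * c ∈ A := by
  obtain ⟨n, b, hb⟩ := hA.exists_basis
  rw [hb] at *
  rw [LinearMap.toMatrix_mul, ← ha.diagonal_diag, ← hc.diagonal_diag, Matrix.diagonal_mul_diagonal]
  exact Matrix.isDiag_diagonal _

lemma IsCartanSubalgebra.mul_comm {A : Submodule K (Module.End K V)}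
    (hA : IsCartanSubalgebra A) {a c : Module.End K V} (ha : a ∈ A) (hc : c ∈ A) :
    a * c = c * a := by
  obtain ⟨n, b, hb⟩ := hA.exists_basis
  rw [hb] at *
  refine (LinearMap.toMatrix b b).injective ?_
  rw [LinearMap.toMatrix_mul, LinearMap.toMatrix_mul, ← ha.diagonal_diag, ← hc.diagonal_diag,
    Matrix.diagonal_mul_diagonal, Matrix.diagonal_mul_diagonal]
  simp_rw [_root_.mul_comm]

end Cartan

/-! ### The algebra structure given by `α` -/

/-- A matrix of functions whose value at a point has linearly independent columns has a left
inverse in a neighbourhood of this point. -/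
lemma exists_left_inverse {m n : Type*} [Fintype m] [Fintype n] [DecidableEq m] [DecidableEq n]
    (x : X) (U : X.Opens) (hx : x ∈ U) (M : Matrix m n Γ(X, U))
    (hM : Function.Injective (M.map (evalAt x U hx)).mulVec) :
    ∃ (V : X.Opens) (_ : x ∈ V) (h : V ≤ U) (L : Matrix n m Γ(X, V)),
      L * M.map (X.presheaf.map (homOfLE h).op) = 1 := by
  obtain ⟨g, hg⟩ := (Matrix.mulVecLin (M.map (evalAt x U hx))).exists_leftInverse_of_injective
    (LinearMap.ker_eq_bot.mpr hM)
  have hg' : LinearMap.toMatrix' g * M.map (evalAt x U hx) = 1 := by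
    have := congrArg LinearMap.toMatrix' hg
    rwa [LinearMap.toMatrix'_comp, ← Matrix.toLin'_apply', LinearMap.toMatrix'_toLin',
      LinearMap.toMatrix'_id] at this
  -- A left inverse over the residue field is lifted entry by entry to germs, and then to functions
  -- near `x`. The product `N` of the lift with `M` is so far the identity only at `x`.
  choose r hr using fun ij : n × m ↦
    IsLocalRing.residue_surjective (R := X.presheaf.stalk x) (LinearMap.toMatrix' g ij.1 ij.2)
  obtain ⟨V, hV, h, c, hc⟩ := exists_common_germ x U hx r
  let L : Matrix n m Γ(X, V) := Matrix.of fun i j ↦ c (i, j)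
  have hL : L.map (evalAt x V hV) = LinearMap.toMatrix' g := by
    ext i j
    change evalAt x V hV (c (i, j)) = _
    rw [evalAt_apply, hc, hr]
  let N := L * M.map (X.presheaf.map (homOfLE h).op)
  have hN : N.map (evalAt x V hV) = 1 := by
    rw [Matrix.map_mul, hL, ← hg']
    congr 1
    ext i j
    exact evalAt_restrict h hV (M i j)
  -- Since `det N` takes the value `1` at `x`, the matrix `N` is invertible on the basic open set of
  -- its determinant. Correcting the lift by `N⁻¹` gives a true left inverse there.
  have hdet : x ∈ X.basicOpen N.det := by
    rw [← evalAt_ne_zero_iff x V hV, RingHom.map_det, RingHom.mapMatrix_apply, hN, Matrix.det_one]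
    exact one_ne_zero
  have hle := X.basicOpen_le N.det
  let ρ := X.presheaf.map (homOfLE hle).op
  have hu : IsUnit (N.map ρ).det := by
    have := RingedSpace.isUnit_res_basicOpen X.toRingedSpace N.det
    rw [← RingHom.mapMatrix_apply ρ.hom, ← RingHom.map_det]
    exact this
  refine ⟨X.basicOpen N.det, hdet, hle.trans h, (N.map ρ)⁻¹ * L.map ρ, ?_⟩
  have : M.map (X.presheaf.map (homOfLE (hle.trans h)).op) =
      (M.map (X.presheaf.map (homOfLE h).op)).map ρ := by
    ext i j
    exact (rmap_comp h hle (M i j)).symm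
  rw [Matrix.mul_assoc, this]
  have h2 : (L.map ρ) * (M.map (X.presheaf.map (homOfLE h).op)).map ρ = N.map ρ :=
    (Matrix.map_mul (f := ρ.hom)).symm
  rw [h2]
  exact Matrix.nonsing_inv_mul _ hu

lemma injective_of_finrank_range_eq {K V W : Type*} [Field K] [AddCommGroup V] [Module K V]
    [AddCommGroup W] [Module K W] [Module.Finite K V] (f : V →ₗ[K] W)
    (h : Module.finrank K (LinearMap.range f) = Module.finrank K V) : Function.Injective f := by
  have h2 := LinearMap.finrank_range_add_finrank_ker f
  rw [← LinearMap.ker_eq_bot, ← Submodule.finrank_eq_zero (R := K)]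
  omega

lemma fiber_injective_of_finrank_range_eq {E : X.Modules} (x : X)
    (f : Fiber E x →ₗ[IsLocalRing.ResidueField (X.presheaf.stalk x)]
      Module.End (IsLocalRing.ResidueField (X.presheaf.stalk x)) (Fiber E x))
    [Module.Finite (IsLocalRing.ResidueField (X.presheaf.stalk x)) (Fiber E x)]
    (h : Module.finrank (IsLocalRing.ResidueField (X.presheaf.stalk x)) (LinearMap.range f) =
      Module.finrank (IsLocalRing.ResidueField (X.presheaf.stalk x)) (Fiber E x)) :
    Function.Injective f := by
  refine injective_of_finrank_range_eq (K := IsLocalRing.ResidueField (X.presheaf.stalk x))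
    (V := Fiber E x)
    (W := Module.End (IsLocalRing.ResidueField (X.presheaf.stalk x)) (Fiber E x)) f ?_
  rw [h]

lemma IsVectorBundle.exists_isFrame_le {d : ℕ} {E : X.Modules} (hE : IsVectorBundle d E) (x : X)
    (U : X.Opens) (hx : x ∈ U) : ∃ (W : X.Opens) (_ : x ∈ W) (_ : W ≤ U) (e : Fin d → Γ(E, W)),
      IsFrame E W e := by
  obtain ⟨V, hV, e, he⟩ := hE.exists_isFrame x
  exact ⟨U ⊓ V, ⟨hx, hV⟩, inf_le_left, _, he.restrict inf_le_right⟩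

/-- `α` makes the fibres of `E` at the closed points Cartan subalgebras. -/
def IsCartan {E : X.Modules} (α : E ⟶ endSheaf E) : Prop :=
  ∀ x : X, IsClosed ({x} : Set X) → IsCartanSubalgebra (fiberImage α x)

/-- The image of the fibre has the same dimension as the fibre, so the kernel is zero. -/
lemma IsCartan.fiberAction_injective {d : ℕ} {E : X.Modules} (hE : IsVectorBundle d E)
    {α : E ⟶ endSheaf E} (hα : IsCartan α) (x : X) (hx : IsClosed ({x} : Set X)) :
    Function.Injective (fiberAction α x) := by
  obtain ⟨U, hxU, e, he⟩ := hE.exists_isFrame x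
  have : Module.Finite (IsLocalRing.ResidueField (X.presheaf.stalk x)) (Fiber E x) :=
    .of_basis (he.fiberBasis x hxU)
  exact fiber_injective_of_finrank_range_eq x (fiberAction α x) (hα x hx).1

lemma IsCartan.action_injective [JacobsonSpace X] [IsReduced X] {d : ℕ} {E : X.Modules}
    (hE : IsVectorBundle d E) {α : E ⟶ endSheaf E} (hα : IsCartan α) (U : X.Opens) :
    Function.Injective (action α U) := by
  rw [injective_iff_map_eq_zero]
  refine fun s hs ↦ section_eq_zero hE s fun x hx hc ↦ hα.fiberAction_injective hE x hc ?_
  rw [fiberAction_value, hs, map_zero]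
  exact end_fiber_ext E x U hx fun V hV hVU s ↦
    (endEval_value E x U hx 0 V hV hVU s).trans (value_zero E x V hV)

/-- Near `x` the map `α` has a left inverse `L`, and the candidate for `s` is `L(φ)`. At a closed
point `y`, where `φ(y) = α(v)` for some `v` in the fibre, it has the value `L(α(v)) = v`. So `α(s)`
and `φ` agree at all closed points of `V`, hence on `V`. -/
lemma IsCartan.exists_action_eq_of_le [JacobsonSpace X] [IsReduced X] {d : ℕ} {E : X.Modules}
    (hE : IsVectorBundle d E) {α : E ⟶ endSheaf E} (hα : IsCartan α) {U : X.Opens}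
    (φ : endSections E U) (x : X) (hx : x ∈ U) (hxc : IsClosed ({x} : Set X))
    (h : ∀ y (hy : y ∈ U), IsClosed ({y} : Set X) → endEval E y U hy φ ∈ fiberImage α y) :
    ∃ (V : X.Opens) (_ : x ∈ V) (hV : V ≤ U) (s : Γ(E, V)), action α V s = endRestrict E hV φ := by
  classical
  obtain ⟨W, hxW, hWU, e, he⟩ := hE.exists_isFrame_le x U hx
  let mat (ψ : endSections E W) : Fin d × Fin d → Γ(X, W) := fun p ↦
    LinearMap.toMatrix (he.basis le_rfl) (he.basis le_rfl) (ψ.1 ⟨W, le_rfl⟩) p.1 p.2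
  have hmat (ψ) (y) (hy : y ∈ W) (p) : evalAt y W hy (mat ψ p) =
      LinearMap.toMatrix (he.fiberBasis y hy) (he.fiberBasis y hy) (endEval E y W hy ψ) p.1 p.2 :=
    (congrFun (congrFun (he.toMatrix_endEval y hy ψ) p.1) p.2).symm
  -- `M` is the matrix of `α` in the frame: its column `i` lists the `d * d` matrix entries of the
  -- endomorphism `α(e i)`.
  let M : Matrix (Fin d × Fin d) (Fin d) Γ(X, W) := Matrix.of fun p i ↦ mat (action α W (e i)) p
  have hM (y) (hy : y ∈ W) (v) : (M.map (evalAt y W hy)).mulVec v = fun p ↦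
      LinearMap.toMatrix (he.fiberBasis y hy) (he.fiberBasis y hy)
        (fiberAction α y (∑ i, v i • he.fiberBasis y hy i)) p.1 p.2 := by
    ext p
    let l : Fiber E y →ₗ[IsLocalRing.ResidueField (X.presheaf.stalk y)]
          IsLocalRing.ResidueField (X.presheaf.stalk y) :=
      (Matrix.entryLinearMap _ _ p.1 p.2).comp
        ((LinearMap.toMatrix (he.fiberBasis y hy) (he.fiberBasis y hy)).toLinearMap.comp
          (fiberAction α y))
    change ∑ i, M.map (evalAt y W hy) p i * v i = l _
    rw [map_sum]
    refine Finset.sum_congr rfl fun i _ ↦ ?_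
    rw [map_smul, smul_eq_mul, mul_comm, he.fiberBasis_apply, Matrix.map_apply]
    refine congrArg (_ * ·) ((hmat _ y hy p).trans ?_)
    rw [← fiberAction_value]
    rfl
  have hMi : Function.Injective (M.map (evalAt x W hxW)).mulVec := by
    intro v w hvw
    rw [hM, hM] at hvw
    have h1 : fiberAction α x _ = fiberAction α x _ :=
      (LinearMap.toMatrix (he.fiberBasis x hxW) (he.fiberBasis x hxW)).injective
        (Matrix.ext fun a b ↦ congrFun hvw (a, b))
    exact (he.fiberBasis x hxW).equivFun.symm.injective
      (by simpa only [Module.Basis.equivFun_symm_apply] using hα.fiberAction_injective hE x hxc h1)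
  obtain ⟨V, hxV, hVW, L, hL⟩ := exists_left_inverse x W hxW M hMi
  let φW := endRestrict E hWU φ
  let c : Fin d → Γ(X, V) := L.mulVec fun p ↦ X.presheaf.map (homOfLE hVW).op (mat φW p)
  let s : Γ(E, V) := ∑ i, c i • E.presheaf.map (homOfLE hVW).op (e i)
  refine ⟨V, hxV, hVW.trans hWU, s, end_ext hE fun y hy hyc ↦ ?_⟩
  obtain ⟨v, hv⟩ := h y (hWU (hVW hy)) hyc
  change fiberAction α y v = _ at hv
  rw [endEval_restrict E _ hy, ← hv, ← fiberAction_value]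
  congr 1
  have hvsum := (he.fiberBasis y (hVW hy)).sum_repr v
  have h2 : (fun p ↦ evalAt y W (hVW hy) (mat φW p)) =
      (M.map (evalAt y W (hVW hy))).mulVec ((he.fiberBasis y (hVW hy)).repr v) := by
    rw [hM, hvsum]
    ext p
    rw [hmat, hv]
    rw [endEval_restrict]
  have h3 : (L.map (evalAt y V hy)) * M.map (evalAt y W (hVW hy)) = 1 := by
    have h4 := congrArg (fun N ↦ N.map (evalAt y V hy)) hL
    rw [Matrix.map_mul, Matrix.map_one _ (map_zero _) (map_one _)] at h4
    rw [← h4]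
    congr 1
    ext i j
    exact (evalAt_restrict hVW hy (M i j)).symm
  have h5 (i) : evalAt y V hy (c i) = (he.fiberBasis y (hVW hy)).repr v i := by
    have h6 : evalAt y V hy (c i) = (L.map (evalAt y V hy)).mulVec
        (fun p ↦ evalAt y W (hVW hy) (mat φW p)) i := by
      simp only [c, Matrix.mulVec, dotProduct, map_sum, map_mul, evalAt_restrict, Matrix.map_apply]
    rw [h6, h2, Matrix.mulVec_mulVec, h3, Matrix.one_mulVec]
  rw [value_sum_smul, ← hvsum]
  refine Finset.sum_congr rfl fun i _ ↦ ?_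
  rw [h5, value_restrict, he.fiberBasis_apply]

/-- An endomorphism of `E|_U` comes from a section of `E` if it does so at the closed points. -/
lemma IsCartan.exists_action_eq [JacobsonSpace X] [IsReduced X] {d : ℕ} {E : X.Modules}
    (hE : IsVectorBundle d E) {α : E ⟶ endSheaf E} (hα : IsCartan α) {U : X.Opens}
    (φ : endSections E U)
    (h : ∀ y (hy : y ∈ U), IsClosed ({y} : Set X) → endEval E y U hy φ ∈ fiberImage α y) :
    ∃ s : Γ(E, U), action α U s = φ := by
  choose V hxV hVU s hs using fun p : {x // x ∈ U ∧ IsClosed ({x} : Set X)} ↦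
    hα.exists_action_eq_of_le hE φ p.1 p.2.1 p.2.2 h
  have hcov : U ≤ iSup V :=
    le_of_closedPoints fun x hx hc ↦ Opens.mem_iSup.mpr ⟨⟨x, hx, hc⟩, hxV _⟩
  -- Neighbourhoods of the closed points cover `U`. The local solutions agree on overlaps because
  -- `α` is injective on sections there.
  obtain ⟨t, ht, -⟩ := TopCat.Sheaf.existsUnique_gluing' ⟨E.presheaf, E.isSheaf⟩ V U
    (fun p ↦ homOfLE (hVU p)) hcov s fun p q ↦ hα.action_injective hE _ <| by
      refine (action_restrict α (inf_le_left : V p ⊓ V q ≤ V p) (s p)).trans ?_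
      refine Eq.trans ?_ (action_restrict α (inf_le_right : V p ⊓ V q ≤ V q) (s q)).symm
      rw [hs, hs]
      rfl
  refine ⟨t, end_ext hE fun x hx hc ↦ ?_⟩
  rw [← endEval_restrict E (hVU ⟨x, hx, hc⟩) (hxV ⟨x, hx, hc⟩), ← action_restrict,
    ← endEval_restrict E (hVU ⟨x, hx, hc⟩) (hxV ⟨x, hx, hc⟩), ← hs]
  congr 2
  exact ht _

/-! ### Localization of the sections of a vector bundle -/

lemma mmap_smul (E : X.Modules) {U V : X.Opens} (h : V ≤ U) (r : Γ(X, U)) (s : Γ(E, U)) :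
    E.presheaf.map (homOfLE h).op (r • s) =
      X.presheaf.map (homOfLE h).op r • E.presheaf.map (homOfLE h).op s :=
  Scheme.Modules.map_smul E (homOfLE h) r s

lemma rmap_pow {U V : X.Opens} (h : V ≤ U) (r : Γ(X, U)) (n : ℕ) :
    X.presheaf.map (homOfLE h).op (r ^ n) = (X.presheaf.map (homOfLE h).op r) ^ n :=
  map_pow (X.presheaf.map (homOfLE h).op).hom r n

/-- Coordinate by coordinate this is the localization property of functions on affine open sets. The
open set `W` is only required to equal `X.basicOpen r`, so that intersections with basic open sets
can be used directly. -/
lemma IsFrame.exists_pow_smul_eq_zero {d : ℕ} {E : X.Modules} {U : X.Opens} {e : Fin d → Γ(E, U)}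
    (he : IsFrame E U e) (hU : IsAffineOpen U) (r : Γ(X, U)) {W : X.Opens} (hW : W ≤ U)
    (hWr : W = X.basicOpen r) (s : Γ(E, U)) (hs : E.presheaf.map (homOfLE hW).op s = 0) :
    ∃ n : ℕ, r ^ n • s = 0 := by
  subst hWr
  have := hU.isLocalization_basicOpen r
  obtain ⟨c, rfl⟩ := he.exists_coord s
  rw [map_sum_smul] at hs
  have h0 := (he _ hW).1 (a₁ := fun i ↦ X.presheaf.map (homOfLE hW).op (c i)) (a₂ := 0)
    (hs.trans (by simp))
  have h1 (i) : ∃ n : ℕ, r ^ n * c i = 0 := by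
    obtain ⟨⟨_, n, rfl⟩, hn⟩ := (IsLocalization.map_eq_zero_iff (Submonoid.powers r)
      Γ(X, X.basicOpen r) (c i)).mp (congrFun h0 i)
    exact ⟨n, hn⟩
  choose n hn using h1
  refine ⟨∑ i, n i, ?_⟩
  rw [Finset.smul_sum]
  refine Finset.sum_eq_zero fun i _ ↦ ?_
  obtain ⟨m, hm⟩ := Nat.exists_eq_add_of_le
    (Finset.single_le_sum (fun _ _ ↦ Nat.zero_le _) (Finset.mem_univ i) : n i ≤ ∑ j, n j)
  rw [hm, smul_smul, add_comm, pow_add, mul_assoc, hn, mul_zero, zero_smul]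

lemma IsFrame.exists_pow_smul_eq_map {d : ℕ} {E : X.Modules} {U : X.Opens} {e : Fin d → Γ(E, U)}
    (he : IsFrame E U e) (hU : IsAffineOpen U) (r : Γ(X, U)) {W : X.Opens} (hW : W ≤ U)
    (hWr : W = X.basicOpen r) (t : Γ(E, W)) : ∃ (n : ℕ) (s : Γ(E, U)),
      E.presheaf.map (homOfLE hW).op s = X.presheaf.map (homOfLE hW).op r ^ n • t := by
  subst hWr
  have := hU.isLocalization_basicOpen r
  obtain ⟨c, rfl⟩ := (he.restrict hW).exists_coord t
  have h1 (i) : ∃ (n : ℕ) (a : Γ(X, U)), X.presheaf.map (homOfLE hW).op a =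
      X.presheaf.map (homOfLE hW).op r ^ n * c i := by
    obtain ⟨n, a, ha⟩ := IsLocalization.Away.surj r (c i)
    refine ⟨n, a, ?_⟩
    rw [mul_comm]
    exact ha.symm
  choose n a ha using h1
  -- The sum of the exponents serves all coordinates at once; the surplus power of `r` goes into
  -- each coefficient.
  refine ⟨∑ i, n i, ∑ i, (r ^ (∑ j, n j - n i) * a i) • e i, ?_⟩
  rw [map_sum_smul, Finset.smul_sum]
  refine Finset.sum_congr rfl fun i _ ↦ ?_
  have hle : n i ≤ ∑ j, n j :=
    Finset.single_le_sum (fun _ _ ↦ Nat.zero_le _) (Finset.mem_univ i)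
  rw [map_mul, ha, rmap_pow, ← mul_assoc, ← pow_add, Nat.sub_add_cancel hle, mul_smul]

/-- Frames exist on basic open sets around every point, and quasi-compactness of `U` leaves finitely
many. Finiteness is what allows exponents to be made uniform below. -/
lemma IsVectorBundle.exists_finset_isFrame {d : ℕ} {E : X.Modules} (hE : IsVectorBundle d E)
    {U : X.Opens} (hU : IsAffineOpen U) : ∃ t : Finset Γ(X, U),
      (∀ g ∈ t, ∃ e : Fin d → Γ(E, X.basicOpen g), IsFrame E (X.basicOpen g) e) ∧
      U ≤ ⨆ g : t, X.basicOpen g.1 := by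
  let S : Set Γ(X, U) := {g | ∃ e : Fin d → Γ(E, X.basicOpen g), IsFrame E (X.basicOpen g) e}
  have hS : U ≤ ⨆ g : S, X.basicOpen g.1 := by
    intro x hx
    obtain ⟨W, hxW, hWU, e, he⟩ := hE.exists_isFrame_le x U hx
    obtain ⟨g, hg, hxg⟩ := hU.exists_basicOpen_le ⟨x, hxW⟩ hx
    exact Opens.mem_iSup.mpr ⟨⟨g, _, he.restrict hg⟩, hxg⟩
  rw [hU.self_le_iSup_basicOpen_iff] at hS
  obtain ⟨t, hts, ht⟩ := (Ideal.span_eq_top_iff_finite _).mp hS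
  exact ⟨t, fun g hg ↦ hts hg, (hU.self_le_iSup_basicOpen_iff (s := (t : Set Γ(X, U)))).mpr ht⟩

lemma IsVectorBundle.exists_pow_smul_eq_zero {d : ℕ} {E : X.Modules} (hE : IsVectorBundle d E)
    {U : X.Opens} (hU : IsAffineOpen U) (r : Γ(X, U)) (s : Γ(E, U))
    (hs : E.presheaf.map (homOfLE (X.basicOpen_le r)).op s = 0) :
    ∃ n : ℕ, r ^ n • s = 0 := by
  obtain ⟨t, ht, hcov⟩ := hE.exists_finset_isFrame hU
  have h1 (g : t) : ∃ n : ℕ, X.presheaf.map (homOfLE (X.basicOpen_le g.1)).op r ^ n •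
      E.presheaf.map (homOfLE (X.basicOpen_le g.1)).op s = 0 := by
    obtain ⟨e, he⟩ := ht g.1 g.2
    refine he.exists_pow_smul_eq_zero (hU.basicOpen g.1) _
      (inf_le_left : X.basicOpen g.1 ⊓ X.basicOpen r ≤ _) ?_ _ ?_
    · exact (X.basicOpen_res _ _).symm
    · rw [mmap_comp, ← mmap_comp E (X.basicOpen_le r) inf_le_right, hs, map_zero]
  choose n hn using h1
  refine ⟨∑ g, n g, section_ext E (fun g : t ↦ X.basicOpen g.1) hcov _ _ fun g ↦ ?_⟩
  obtain ⟨m, hm⟩ := Nat.exists_eq_add_of_le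
    (Finset.single_le_sum (fun _ _ ↦ Nat.zero_le _) (Finset.mem_univ g) : n g ≤ ∑ j, n j)
  rw [← mmap_comp E (X.basicOpen_le g.1) inf_le_right, mmap_smul, rmap_pow, hm, add_comm, pow_add,
    mul_smul, hn, smul_zero, map_zero, map_zero]

/-- After multiplication by `r ^ N` the section extends over each basic open set with a frame. Two
extensions agree where `r` is invertible, so a further factor `r ^ M` makes them agree on overlaps
and glue. The total exponent is `N + M`. -/
lemma IsVectorBundle.exists_pow_smul_eq_map {d : ℕ} {E : X.Modules} (hE : IsVectorBundle d E)
    {U : X.Opens} (hU : IsAffineOpen U) (r : Γ(X, U)) (t : Γ(E, X.basicOpen r)) :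
    ∃ (n : ℕ) (s : Γ(E, U)), E.presheaf.map (homOfLE (X.basicOpen_le r)).op s =
      X.presheaf.map (homOfLE (X.basicOpen_le r)).op r ^ n • t := by
  obtain ⟨T, hT, hcov⟩ := hE.exists_finset_isFrame hU
  let D (g : T) : X.Opens := X.basicOpen g.1
  have hD (g : T) : D g ≤ U := X.basicOpen_le g.1
  have h1 (g : T) : ∃ (n : ℕ) (s : Γ(E, D g)),
      E.presheaf.map (homOfLE (inf_le_left : D g ⊓ X.basicOpen r ≤ D g)).op s =
        X.presheaf.map (homOfLE ((inf_le_left : D g ⊓ X.basicOpen r ≤ D g).trans (hD g))).op r ^ n •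
          E.presheaf.map (homOfLE (inf_le_right : D g ⊓ X.basicOpen r ≤ _)).op t := by
    obtain ⟨e, he⟩ := hT g.1 g.2
    obtain ⟨n, s, hs⟩ := he.exists_pow_smul_eq_map (hU.basicOpen g.1)
      (X.presheaf.map (homOfLE (hD g)).op r) (inf_le_left : D g ⊓ X.basicOpen r ≤ D g)
      (X.basicOpen_res _ _).symm (E.presheaf.map (homOfLE inf_le_right).op t)
    rw [rmap_comp] at hs
    exact ⟨n, s, hs⟩
  choose n s hs using h1
  let N := ∑ g, n g
  have hN (g : T) : n g ≤ N :=
    Finset.single_le_sum (fun _ _ ↦ Nat.zero_le _) (Finset.mem_univ g)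
  let s' (g : T) : Γ(E, D g) := X.presheaf.map (homOfLE (hD g)).op r ^ (N - n g) • s g
  have hs' (g : T) : E.presheaf.map (homOfLE (inf_le_left : D g ⊓ X.basicOpen r ≤ D g)).op (s' g) =
        X.presheaf.map (homOfLE ((inf_le_left : D g ⊓ X.basicOpen r ≤ D g).trans (hD g))).op r ^ N •
          E.presheaf.map (homOfLE (inf_le_right : D g ⊓ X.basicOpen r ≤ _)).op t := by
    rw [mmap_smul, hs, rmap_pow, rmap_comp, smul_smul, ← pow_add, Nat.sub_add_cancel (hN g)]
  clear_value s'
  have h2 (p : T × T) : ∃ m : ℕ, X.presheaf.map (homOfLE (inf_le_left.trans (hD p.1) :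
      D p.1 ⊓ D p.2 ≤ U)).op r ^ m • (E.presheaf.map (homOfLE inf_le_left).op (s' p.1) -
        E.presheaf.map (homOfLE inf_le_right).op (s' p.2)) = 0 := by
    obtain ⟨e, he⟩ := hT p.1.1 p.1.2
    have haff : IsAffineOpen (D p.1 ⊓ D p.2) := by
      have := hU.basicOpen (p.1.1 * p.2.1)
      rwa [X.basicOpen_mul] at this
    refine (he.restrict (inf_le_left : D p.1 ⊓ D p.2 ≤ D p.1)).exists_pow_smul_eq_zero haff _
      (inf_le_left : D p.1 ⊓ D p.2 ⊓ X.basicOpen r ≤ _) (X.basicOpen_res _ _).symm _ ?_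
    have ha : D p.1 ⊓ D p.2 ⊓ X.basicOpen r ≤ D p.1 ⊓ X.basicOpen r :=
      inf_le_inf_right _ inf_le_left
    have hb : D p.1 ⊓ D p.2 ⊓ X.basicOpen r ≤ D p.2 ⊓ X.basicOpen r :=
      inf_le_inf_right _ inf_le_right
    rw [map_sub, mmap_comp, mmap_comp, ← mmap_comp E inf_le_left ha, ← mmap_comp E inf_le_left hb,
      hs', hs', mmap_smul, mmap_smul, rmap_pow, rmap_pow, rmap_comp, rmap_comp, mmap_comp,
      mmap_comp, sub_self]
  choose m hm using h2
  let M := ∑ p, m p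
  have hM (p : T × T) : m p ≤ M :=
    Finset.single_le_sum (fun _ _ ↦ Nat.zero_le _) (Finset.mem_univ p)
  obtain ⟨a, ha, -⟩ := TopCat.Sheaf.existsUnique_gluing' ⟨E.presheaf, E.isSheaf⟩ D U
    (fun g ↦ homOfLE (hD g)) hcov (fun g ↦ X.presheaf.map (homOfLE (hD g)).op r ^ M • s' g) <| by
    intro g h
    have h3 := hm (g, h)
    obtain ⟨l, hl⟩ := Nat.exists_eq_add_of_le (hM (g, h))
    refine sub_eq_zero.mp ?_
    have e1 := mmap_smul E (inf_le_left : D g ⊓ D h ≤ D g)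
      (X.presheaf.map (homOfLE (hD g)).op r ^ M) (s' g)
    have e2 := mmap_smul E (inf_le_right : D g ⊓ D h ≤ D h)
      (X.presheaf.map (homOfLE (hD h)).op r ^ M) (s' h)
    rw [rmap_pow, rmap_comp] at e1 e2
    refine (congrArg₂ (· - ·) e1 e2).trans ?_
    rw [← smul_sub, hl, add_comm, pow_add, mul_smul]
    exact (congrArg _ h3).trans (smul_zero _)
  refine ⟨N + M, a, section_ext E D ((X.basicOpen_le r).trans hcov) _ _ fun g ↦ ?_⟩
  have ha' : E.presheaf.map (homOfLE (hD g)).op a = _ := ha g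
  have hle : X.basicOpen r ⊓ D g ≤ D g ⊓ X.basicOpen r := inf_comm _ _ |>.le
  rw [mmap_comp, ← mmap_comp E (hD g) inf_le_right, ha', mmap_smul, rmap_pow, rmap_comp,
    mmap_smul, rmap_pow, rmap_comp, ← mmap_comp E inf_le_left hle, hs', mmap_smul, rmap_pow,
    rmap_comp, mmap_comp, smul_smul, ← pow_add, add_comm M N]

/-! ### Relative spectrum of a quasi-coherent algebra -/

section RelativeSpec

open Scheme.AffineZariskiSite

variable {F : X.AffineZariskiSiteᵒᵖ ⥤ CommRingCat.{u}}
  {η : (toOpensFunctor X).op ⋙ X.presheaf ⟶ F} (H : η.Coequifibered)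

/-- The relative spectrum of a quasi-coherent algebra given on the affine open sets. -/
def relSpec : Scheme.{u} := (relativeGluingData H).glued

/-- The structure morphism of the relative spectrum. -/
def relSpecHom : relSpec H ⟶ X := (relativeGluingData H).toBase

instance : ((relativeGluingData H).functor ⋙ Scheme.forget).IsLocallyDirected :=
  Scheme.Cover.RelativeGluingData.instIsLocallyDirectedI₀CompFunctorForgetOfIsThin ..

/-- The inclusion of the part of the relative spectrum over an affine open set. -/
def relSpecι (U : X.AffineZariskiSite) : Spec (F.obj (op U)) ⟶ relSpec H :=
  (relativeGluingData H).cover.f U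

instance (U : X.AffineZariskiSite) : IsOpenImmersion (relSpecι H U) :=
  (relativeGluingData H).cover.map_prop U

lemma relSpecι_relSpecHom (U : X.AffineZariskiSite) :
    relSpecι H U ≫ relSpecHom H = Spec.map (η.app (op U)) ≫ U.2.fromSpec :=
  Limits.colimit.ι_desc _ _

lemma map_relSpecι {U V : X.AffineZariskiSite} (h : V ⟶ U) :
    Spec.map (F.map h.op) ≫ relSpecι H U = relSpecι H V :=
  Limits.colimit.w (relativeGluingData H).functor h

lemma relSpecHom_preimage (U : X.AffineZariskiSite) :
    relSpecHom H ⁻¹ᵁ U.1 = (relSpecι H U).opensRange := by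
  have := (relativeGluingData H).toBase_preimage_eq_opensRange_ι U
  refine Eq.trans ?_ this
  have h : U.1 = ((directedCover X).f U).opensRange := by
    exact (Scheme.Opens.opensRange_ι U.1).symm
  exact congrArg (fun V ↦ relSpecHom H ⁻¹ᵁ V) h

lemma top_le_preimage (U : X.AffineZariskiSite) :
    ⊤ ≤ relSpecι H U ⁻¹ᵁ relSpecHom H ⁻¹ᵁ U.1 := by
  rw [relSpecHom_preimage, Scheme.Hom.preimage_opensRange]

/-- Functions on the part of the relative spectrum over an affine open set. -/
def relSpecEval (U : X.AffineZariskiSite) :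
    Γ(relSpec H, relSpecHom H ⁻¹ᵁ U.1) ⟶ F.obj (op U) :=
  (relSpecι H U).appLE _ ⊤ (top_le_preimage H U) ≫ (Scheme.ΓSpecIso _).hom

/-- The chart over `U` is an open immersion whose image is exactly the preimage of `U`. -/
instance instIsIsoEval (U : X.AffineZariskiSite) : IsIso (relSpecEval H U) := by
  have h : relSpecHom H ⁻¹ᵁ U.1 = relSpecι H U ''ᵁ ⊤ := by
    rw [relSpecHom_preimage, Scheme.Hom.image_top_eq_opensRange]
  have : IsIso ((relSpecι H U).appLE _ ⊤ (top_le_preimage H U)) := by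
    have h1 := (relSpecι H U).map_appLE (Scheme.Hom.preimage_image_eq _ _).ge (eqToHom h.symm).op
    rw [← h1, ← Scheme.Hom.appIso_hom']
    infer_instance
  unfold relSpecEval
  infer_instance

lemma appLE_top_of_comp_eq {A B C : Scheme.{u}} {g : A ⟶ B} {j : B ⟶ C} {j' : A ⟶ C}
    (h : g ≫ j = j') (W : C.Opens) (e : ⊤ ≤ j ⁻¹ᵁ W) (e' : ⊤ ≤ j' ⁻¹ᵁ W) :
    j'.appLE W ⊤ e' = j.appLE W ⊤ e ≫ g.appTop := by
  subst h
  rw [Scheme.Hom.appTop, Scheme.Hom.app_eq_appLE]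
  exact (Scheme.Hom.appLE_comp_appLE g j W ⊤ ⊤ e _).symm

lemma relSpecEval_naturality {U V : X.AffineZariskiSite} (h : V ⟶ U) (hle : V.1 ≤ U.1) :
    (relSpec H).presheaf.map (homOfLE ((relSpecHom H).preimage_mono hle)).op ≫
      relSpecEval H V = relSpecEval H U ≫ F.map h.op := by
  rw [relSpecEval, relSpecEval, Category.assoc, ← Scheme.ΓSpecIso_naturality,
    Scheme.Hom.map_appLE_assoc, appLE_top_of_comp_eq (map_relSpecι H h) _
    (top_le_preimage H U), Category.assoc]

/-- Under the identification of functions over `U` with `F(U)`, pullback of functions becomes the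
structure map `η`. So the algebra structure, and not just the ring, is recovered. -/
lemma app_relSpecEval (U : X.AffineZariskiSite) :
    (relSpecHom H).app U.1 ≫ relSpecEval H U = η.app (op U) := by
  have h := relSpecι_relSpecHom H U
  have h2 := appLE_top_of_comp_eq h.symm U.1 U.2.fromSpec_preimage_self.ge (top_le_preimage H U)
  have h3 : U.2.fromSpec.appLE U.1 ⊤ U.2.fromSpec_preimage_self.ge =
      (Scheme.ΓSpecIso Γ(X, U.1)).inv := by
    rw [Scheme.Hom.appLE, IsAffineOpen.fromSpec_app_self, Category.assoc, ← Functor.map_comp]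
    exact (congrArg _ ((Spec Γ(X, U.1)).presheaf.map_id _)).trans (Category.comp_id _)
  have h4 : (relSpecHom H).app U.1 ≫ (relSpecι H U).appLE _ ⊤ (top_le_preimage H U) =
      (Scheme.ΓSpecIso Γ(X, U.1)).inv ≫ (Spec.map (η.app (op U))).appTop :=
    (Scheme.Hom.comp_appLE (relSpecι H U) (relSpecHom H) U.1 ⊤ _).symm.trans
      (h2.trans (congrArg (· ≫ _) h3))
  rw [relSpecEval, reassoc_of% h4]
  exact (congrArg _ (Scheme.ΓSpecIso_naturality (η.app (op U)))).trans
    (Iso.inv_hom_id_assoc _ _)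

instance : IsAffineHom (relSpecHom H) := by
  refine isAffineHom_of_forall_exists_isAffineOpen _ fun x ↦ ?_
  obtain ⟨_, ⟨U, hU, rfl⟩, hxU, -⟩ :=
    X.isBasis_affineOpens.exists_subset_of_mem_open (Set.mem_univ x) isOpen_univ
  refine ⟨U, hxU, hU, ?_⟩
  let V : X.AffineZariskiSite := ⟨U, hU⟩
  have : IsAffineOpen (relSpecι H V).opensRange := isAffineOpen_opensRange (relSpecι H V)
  rwa [← relSpecHom_preimage H V] at this

end RelativeSpec

/-- A sheaf of algebras which is quasi-coherent is the direct image of the structure sheaf of a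
scheme which is affine over `X`. -/
theorem exists_isAffineHom_pushforward_iso (F : TopCat.Sheaf CommRingCat.{u} X)
    (η : X.presheaf ⟶ F.presheaf)
    (H : ((Scheme.AffineZariskiSite.toOpensFunctor X).op.whiskerLeft η).Coequifibered) :
    ∃ (Y : Scheme.{u}) (f : Y ⟶ X) (_ : IsAffineHom f)
      (θ : F.presheaf ≅ (Opens.map f.base).op ⋙ Y.presheaf),
      ∀ U, η.app (op U) ≫ θ.hom.app (op U) = f.app U := by
  let G := Scheme.AffineZariskiSite.toOpensFunctor X
  let f := relSpecHom H
  let P : TopCat.Sheaf CommRingCat.{u} X :=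
    (TopCat.Sheaf.pushforward _ f.base).obj (relSpec H).sheaf
  let i : G.op ⋙ P.presheaf ≅ G.op ⋙ F.presheaf :=
    NatIso.ofComponents (fun U ↦ @asIso _ _ _ _ (relSpecEval H U.unop)
      (instIsIsoEval H U.unop)) fun {U V} h ↦
      relSpecEval_naturality H h.unop (Scheme.AffineZariskiSite.toOpens_mono h.unop.le)
  -- Affine open sets form a basis, so an isomorphism of sheaves given on them extends uniquely. The
  -- same density reduces the compatibility with `η` to affine open sets.
  let θ : F.presheaf ≅ P.presheaf := Functor.IsCoverDense.presheafIso
    (K := Opens.grothendieckTopology X) (G := G) (ℱ := F) (ℱ' := P) i.symm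
  refine ⟨relSpec H, f, inferInstance, θ, ?_⟩
  have hθ : Functor.whiskerLeft G.op θ.hom = i.inv :=
    Functor.IsCoverDense.sheafHom_restrict_eq (K := Opens.grothendieckTopology X) (G := G)
      (ℱ := F.presheaf) (ℱ' := P) i.inv
  have key : η ≫ θ.hom = f.c := by
    refine (Functor.whiskerLeft_obj_map_bijective_of_isCoverDense
      (K := Opens.grothendieckTopology X)
      G X.presheaf P.presheaf P.property).1 ?_
    change Functor.whiskerLeft G.op η ≫ Functor.whiskerLeft G.op θ.hom =
      Functor.whiskerLeft G.op f.c
    rw [hθ]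
    refine (Iso.comp_inv_eq i).mpr ?_
    ext1
    ext1 U
    exact (app_relSpecEval H U.unop).symm
  exact fun U ↦ congr_app key (op U)

/-! ### The algebra structure of a bundle of Cartan subalgebras -/

section CartanRing

lemma endEval_action_mem {E : X.Modules} (α : E ⟶ endSheaf E) (x : X) (U : X.Opens) (hx : x ∈ U)
    (s : Γ(E, U)) :
    endEval E x U hx (action α U s) ∈ fiberImage α x :=
  ⟨value E x U hx s, fiberAction_value α x U hx s⟩

variable [JacobsonSpace X] [IsReduced X] {d : ℕ} {E : X.Modules} (hE : IsVectorBundle d E)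
  {α : E ⟶ endSheaf E} (hα : IsCartan α)

/-- The endomorphisms of `E|_U` given by sections of `E` over `U`. -/
def cartanSubring (U : X.Opens) :
    Subring (∀ V : {V : X.Opens // V ≤ U}, Module.End Γ(X, V.1) Γ(E, V.1)) where
  carrier := {φ | ∃ s, (action α U s).1 = φ}
  zero_mem' := ⟨0, congrArg Subtype.val (map_zero (action α U))⟩
  add_mem' := by
    rintro _ _ ⟨s, rfl⟩ ⟨t, rfl⟩
    exact ⟨s + t, congrArg Subtype.val (map_add (action α U) s t)⟩
  neg_mem' := by
    rintro _ ⟨s, rfl⟩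
    exact ⟨-s, congrArg Subtype.val (map_neg (action α U) s)⟩
  -- Unit and products: at closed points they lie in the Cartan subalgebras, which are unital
  -- algebras, so they come from sections of `E`.
  one_mem' := by
    obtain ⟨s, hs⟩ := hα.exists_action_eq hE (U := U) 1 fun y hy hc ↦ by
      rw [endEval_one]
      exact (hα y hc).one_mem
    exact ⟨s, congrArg Subtype.val hs⟩
  mul_mem' := by
    rintro _ _ ⟨s, rfl⟩ ⟨t, rfl⟩
    obtain ⟨u, hu⟩ := hα.exists_action_eq hE (U := U) (action α U s * action α U t) fun y hy hc ↦ by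
      rw [endEval_mul]
      exact (hα y hc).mul_mem (endEval_action_mem α y U hy s) (endEval_action_mem α y U hy t)
    exact ⟨u, congrArg Subtype.val hu⟩

/-- Commutativity holds in the Cartan subalgebras at closed points, and endomorphisms of a vector
bundle are determined by their values there. -/
instance (U : X.Opens) : CommRing (cartanSubring hE hα U) where
  mul_comm := by
    rintro ⟨_, s, rfl⟩ ⟨_, t, rfl⟩
    have h : action α U s * action α U t = action α U t * action α U s := by
      refine end_ext hE fun x hx hc ↦ ?_
      rw [endEval_mul, endEval_mul]
      exact (hα x hc).mul_comm (endEval_action_mem α x U hx s) (endEval_action_mem α x U hx t)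
    exact Subtype.ext (congrArg (Subtype.val : endSections E U → _) h)

/-- A section of `E`, as an element of the ring of endomorphisms. -/
def toCartan (U : X.Opens) : Γ(E, U) →+ cartanSubring hE hα U where
  toFun s := ⟨(action α U s).1, s, rfl⟩
  map_zero' := Subtype.ext (congrArg (Subtype.val : endSections E U → _) (map_zero (action α U)))
  map_add' s t := Subtype.ext
    (congrArg (Subtype.val : endSections E U → _) (map_add (action α U) s t))

lemma toCartan_bijective (U : X.Opens) : Function.Bijective (toCartan hE hα U) := by
  refine ⟨fun s t h ↦ hα.action_injective hE U (Subtype.ext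
    (congrArg (Subtype.val : cartanSubring hE hα U → _) h)), ?_⟩
  rintro ⟨_, s, rfl⟩
  exact ⟨s, rfl⟩

/-- The sections of `E` are the elements of the ring of endomorphisms. -/
def cartanEquiv (U : X.Opens) : Γ(E, U) ≃+ cartanSubring hE hα U :=
  AddEquiv.ofBijective (toCartan hE hα U) (toCartan_bijective hE hα U)

lemma cartanEquiv_val (U : X.Opens) (s : Γ(E, U)) :
    (cartanEquiv hE hα U s).1 = (action α U s).1 := rfl

/-- Restriction of endomorphisms of `E` given by sections. -/
def cartanRestrict {U V : X.Opens} (h : V ≤ U) :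
    cartanSubring hE hα U →+* cartanSubring hE hα V where
  toFun φ := ⟨fun W ↦ φ.1 ⟨W.1, W.2.trans h⟩, by
    obtain ⟨_, s, rfl⟩ := φ
    exact ⟨E.presheaf.map (homOfLE h).op s, congrArg Subtype.val (action_restrict α h s)⟩⟩
  map_one' := rfl
  map_mul' _ _ := rfl
  map_zero' := rfl
  map_add' _ _ := rfl

lemma cartanEquiv_restrict {U V : X.Opens} (h : V ≤ U) (s : Γ(E, U)) :
    cartanEquiv hE hα V (E.presheaf.map (homOfLE h).op s) =
      cartanRestrict hE hα h (cartanEquiv hE hα U s) :=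
  Subtype.ext (congrArg (Subtype.val : endSections E V → _) (action_restrict α h s))

/-- The scalar endomorphisms of `E`. -/
def cartanUnit (U : X.Opens) : Γ(X, U) →+* cartanSubring hE hα U where
  toFun r := ⟨fun V ↦ X.presheaf.map (homOfLE V.2).op r • 1, by
    obtain ⟨s, hs⟩ := (1 : cartanSubring hE hα U).2
    refine ⟨r • s, (congrArg Subtype.val (action_smul α U r s)).trans (funext fun V ↦ ?_)⟩
    rw [smul_val, hs]
    rfl⟩
  map_one' := Subtype.ext <| funext fun V ↦ by
    refine (congrArg (· • (1 : Module.End Γ(X, V.1) Γ(E, V.1)))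
      (map_one (X.presheaf.map (homOfLE V.2).op).hom)).trans (one_smul _ _)
  map_mul' r r' := Subtype.ext <| funext fun V ↦ by
    refine (congrArg (· • (1 : Module.End Γ(X, V.1) Γ(E, V.1)))
      (map_mul (X.presheaf.map (homOfLE V.2).op).hom r r')).trans ?_
    refine (mul_smul _ _ _).trans ?_
    exact (smul_one_mul (X.presheaf.map (homOfLE V.2).op r)
      (X.presheaf.map (homOfLE V.2).op r' • (1 : Module.End Γ(X, V.1) Γ(E, V.1)))).symm
  map_zero' := Subtype.ext <| funext fun V ↦ by
    refine (congrArg (· • (1 : Module.End Γ(X, V.1) Γ(E, V.1)))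
      (map_zero (X.presheaf.map (homOfLE V.2).op).hom)).trans (zero_smul _ _)
  map_add' r r' := Subtype.ext <| funext fun V ↦ by
    refine (congrArg (· • (1 : Module.End Γ(X, V.1) Γ(E, V.1)))
      (map_add (X.presheaf.map (homOfLE V.2).op).hom r r')).trans (add_smul _ _ _)

lemma cartanEquiv_smul (U : X.Opens) (r : Γ(X, U)) (s : Γ(E, U)) :
    cartanEquiv hE hα U (r • s) = cartanUnit hE hα U r * cartanEquiv hE hα U s :=
  Subtype.ext <| funext fun V ↦ by
    refine ((congrFun (cartanEquiv_val hE hα U (r • s)) V).trans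
      (congrFun (congrArg (Subtype.val : endSections E U → _) (action_smul α U r s)) V)).trans ?_
    exact (smul_one_mul (X.presheaf.map (homOfLE V.2).op r) ((action α U s).1 V)).symm

end CartanRing

/-! ### Algebra structures on a sheaf of modules -/

/-- A presheaf of `𝒪_X`-algebras whose underlying presheaf of modules is `E`. -/
structure AlgebraData (E : X.Modules) where
  ring : X.Opensᵒᵖ ⥤ CommRingCat.{u}
  unit : X.presheaf ⟶ ring
  equiv (U : X.Opens) : Γ(E, U) ≃+ ring.obj (op U)
  equiv_map {U V : X.Opens} (h : V ≤ U) (s : Γ(E, U)) :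
    equiv V (E.presheaf.map (homOfLE h).op s) = ring.map (homOfLE h).op (equiv U s)
  equiv_smul (U : X.Opens) (r : Γ(X, U)) (s : Γ(E, U)) :
    equiv U (r • s) = unit.app (op U) r * equiv U s

/-- The sheaf of algebras given by a bundle of Cartan subalgebras. -/
def IsCartan.algebraData [JacobsonSpace X] [IsReduced X] {d : ℕ} {E : X.Modules}
    (hE : IsVectorBundle d E) {α : E ⟶ endSheaf E} (hα : IsCartan α) : AlgebraData E where
  ring :=
    { obj U := .of (cartanSubring hE hα U.unop)
      map i := CommRingCat.ofHom (cartanRestrict hE hα i.unop.le)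
      map_id _ := rfl
      map_comp _ _ := rfl }
  unit :=
    { app U := CommRingCat.ofHom (cartanUnit hE hα U.unop)
      naturality U V i := by
        refine CommRingCat.hom_ext (RingHom.ext fun r ↦ Subtype.ext (funext fun W ↦ ?_))
        exact congrArg (· • (1 : Module.End Γ(X, W.1) Γ(E, W.1))) (rmap_comp i.unop.le W.2 r) }
  equiv := cartanEquiv hE hα
  equiv_map h s := cartanEquiv_restrict hE hα h s
  equiv_smul U r s := cartanEquiv_smul hE hα U r s

namespace AlgebraData

variable {E : X.Modules} (A : AlgebraData E)

lemma unit_map {U V : X.Opens} (h : V ≤ U) (r : Γ(X, U)) :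
    A.ring.map (homOfLE h).op (A.unit.app (op U) r) =
      A.unit.app (op V) (X.presheaf.map (homOfLE h).op r) :=
  (ConcreteCategory.congr_hom (A.unit.naturality (homOfLE h).op) r).symm

/-- The sheaf condition concerns only the underlying sets, which are those of `E`. -/
lemma isSheaf : TopCat.Presheaf.IsSheaf A.ring := by
  rw [TopCat.Presheaf.isSheaf_iff_isSheaf_comp (forget CommRingCat.{u})]
  have h1 := (TopCat.Presheaf.isSheaf_iff_isSheaf_comp (forget Ab.{u}) E.presheaf).mp E.isSheaf
  refine TopCat.Presheaf.isSheaf_of_iso (NatIso.ofComponents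
    (fun U ↦ (A.equiv U.unop).toEquiv.toIso) fun {U V} i ↦ ?_) h1
  ext s
  exact A.equiv_map i.unop.le s

/-- This is quasi-coherence: the ring over `X.basicOpen r` is the localization at `r` of the ring
over `U`. Only the underlying module matters, so the two localization lemmas for vector bundles give
surjectivity and injectivity up to powers of `r`. -/
lemma coequifibered {d : ℕ} (hE : IsVectorBundle d E) :
    ((Scheme.AffineZariskiSite.toOpensFunctor X).op.whiskerLeft A.unit).Coequifibered := by
  refine Scheme.AffineZariskiSite.coequifibered_iff_forall_isLocalizationAway.mpr fun U r ↦ ?_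
  let ρ := A.ring.map (homOfLE (X.basicOpen_le r)).op
  let := ρ.hom.toAlgebra
  have hU : IsAffineOpen U.1 := U.2
  have hunit (n : ℕ) : ρ (A.unit.app (op U.1) r ^ n) =
      A.unit.app (op (X.basicOpen r)) (X.presheaf.map (homOfLE (X.basicOpen_le r)).op r ^ n) := by
    rw [map_pow, map_pow]
    exact congrArg (· ^ n) (A.unit_map (X.basicOpen_le r) r)
  refine IsLocalization.Away.mk (R := A.ring.obj (op U.1)) (S := A.ring.obj (op (X.basicOpen r)))
    (A.unit.app (op U.1) r) ?_ (fun b ↦ ?_) fun a b hab ↦ ?_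
  · have h := (RingedSpace.isUnit_res_basicOpen X.toRingedSpace r).map
      (A.unit.app (op (X.basicOpen r))).hom
    refine (congrArg IsUnit ?_).mp h
    exact (A.unit_map (X.basicOpen_le r) r).symm
  · obtain ⟨t, rfl⟩ := (A.equiv _).surjective b
    obtain ⟨n, s, hs⟩ := hE.exists_pow_smul_eq_map hU r t
    refine ⟨n, A.equiv _ s, ?_⟩
    refine Eq.trans ?_ (A.equiv_map (X.basicOpen_le r) s)
    rw [hs, A.equiv_smul, ← hunit, mul_comm, map_pow]
    rfl
  · obtain ⟨s, hs⟩ := (A.equiv _).surjective (a - b)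
    have h0 : E.presheaf.map (homOfLE (X.basicOpen_le r)).op s = 0 := by
      refine (A.equiv _).injective ?_
      rw [A.equiv_map, hs, map_zero, map_sub]
      exact sub_eq_zero.mpr hab
    obtain ⟨n, hn⟩ := hE.exists_pow_smul_eq_zero hU r s h0
    refine ⟨n, sub_eq_zero.mp ?_⟩
    rw [← mul_sub, ← hs, ← map_pow, ← A.equiv_smul, hn, map_zero]

end AlgebraData

/-! ### Morphisms of sheaves of modules -/

/-- A morphism of sheaves of modules, given on sections. -/
def homOfSections {M N : X.Modules} (φ : ∀ U, Γ(M, U) →+ Γ(N, U))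
    (hmap : ∀ {U V : X.Opens} (h : V ≤ U) (s : Γ(M, U)),
      φ V (M.presheaf.map (homOfLE h).op s) = N.presheaf.map (homOfLE h).op (φ U s))
    (hsmul : ∀ (U : X.Opens) (r : Γ(X, U)) (s : Γ(M, U)), φ U (r • s) = r • φ U s) : M ⟶ N where
  val := PresheafOfModules.homMk
    { app U := AddCommGrpCat.ofHom (φ U.unop)
      naturality _ _ i := AddCommGrpCat.hom_ext (AddMonoidHom.ext fun s ↦ hmap i.unop.le s) }
    fun U r s ↦ hsmul U.unop r s

lemma nonempty_iso_of_sections {M N : X.Modules} (e : ∀ U, Γ(M, U) ≃+ Γ(N, U))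
    (hmap : ∀ {U V : X.Opens} (h : V ≤ U) (s : Γ(M, U)),
      e V (M.presheaf.map (homOfLE h).op s) = N.presheaf.map (homOfLE h).op (e U s))
    (hsmul : ∀ (U : X.Opens) (r : Γ(X, U)) (s : Γ(M, U)), e U (r • s) = r • e U s) :
    Nonempty (M ≅ N) := by
  let φ : M ⟶ N := homOfSections (fun U ↦ (e U).toAddMonoidHom) hmap hsmul
  have : IsIso φ := Scheme.Modules.Hom.isIso_iff_isIso_app.mpr fun U ↦
    (ConcreteCategory.isIso_iff_bijective _).mpr (e U).bijective
  exact ⟨asIso φ⟩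

/-- The algebra given by a sheaf of algebras on a vector bundle is the direct image of the structure
sheaf of a scheme which is affine over `X`. -/
theorem AlgebraData.exists_isAffineHom {E : X.Modules} (A : AlgebraData E) {d : ℕ}
    (hE : IsVectorBundle d E) :
    ∃ (Y : Scheme.{u}) (f : Y ⟶ X) (_ : IsAffineHom f)
      (θ : ∀ U, A.ring.obj (op U) ≃+* Γ(Y, f ⁻¹ᵁ U)),
      (∀ U r, θ U (A.unit.app (op U) r) = f.app U r) ∧
      Nonempty (directImageStructureSheaf f ≅ E) := by
  obtain ⟨Y, f, hf, θ, hθ⟩ := exists_isAffineHom_pushforward_iso ⟨A.ring, A.isSheaf⟩ A.unit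
    (A.coequifibered hE)
  let θ' (U : X.Opens) : A.ring.obj (op U) ≃+* Γ(Y, f ⁻¹ᵁ U) :=
    (θ.app (op U)).commRingCatIsoToRingEquiv
  have hθ' (U r) : θ' U (A.unit.app (op U) r) = f.app U r := ConcreteCategory.congr_hom (hθ U) r
  refine ⟨Y, f, hf, θ', hθ', ?_⟩
  refine (nonempty_iso_of_sections (M := E) (N := directImageStructureSheaf f)
    (fun U ↦ (A.equiv U).trans (θ' U).toAddEquiv) (fun {U V} h s ↦ ?_) fun U r s ↦ ?_).map Iso.symm
  · change θ' V (A.equiv V _) = _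
    rw [A.equiv_map]
    exact ConcreteCategory.congr_hom (θ.hom.naturality (homOfLE h).op) (A.equiv U s)
  · change θ' U (A.equiv U _) = f.app U r * θ' U (A.equiv U s)
    rw [A.equiv_smul, map_mul, hθ']

/-! ### A criterion for unramified algebras -/

/-- A finite algebra is unramified if modulo each maximal ideal of the base ring it is spanned by
idempotents. -/
lemma formallyUnramified_of_span_idempotent {R A : Type u} [CommRing R] [CommRing A] [Algebra R A]
    [Module.Finite R A] (h : ∀ m : Ideal R, m.IsMaximal →
      Submodule.span R {e : A | e * e - e ∈ m.map (algebraMap R A)} = ⊤) :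
    Algebra.FormallyUnramified R A := by
  rw [Algebra.formallyUnramified_iff]
  have : Module.Finite R (Ω[A⁄R]) := .trans A _
  -- It is enough to see that the differentials of the elements which are idempotent modulo `m A`
  -- lie in `m Ω`: these elements span `A` over `R`, and the differentials of `A` generate `Ω`.
  have key (m : Ideal R) (hm : m.IsMaximal) : (⊤ : Submodule R (Ω[A⁄R])) ≤ m • ⊤ := by
    have h3 (a : A) (w : Ω[A⁄R]) (hw : w ∈ m • (⊤ : Submodule R (Ω[A⁄R]))) :
        a • w ∈ m • (⊤ : Submodule R (Ω[A⁄R])) := by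
      refine Submodule.smul_induction_on hw (fun r hr n _ ↦ ?_) fun x y hx hy ↦ ?_
      · rw [smul_comm]
        exact Submodule.smul_mem_smul hr trivial
      · rw [smul_add]
        exact add_mem hx hy
    have h4 (x : A) (w : Ω[A⁄R]) (hx : x ∈ m.map (algebraMap R A)) :
        x • w ∈ m • (⊤ : Submodule R (Ω[A⁄R])) := by
      induction hx using Submodule.span_induction with
      | mem x hx =>
        obtain ⟨r, hr, rfl⟩ := hx
        rw [algebraMap_smul]
        exact Submodule.smul_mem_smul hr trivial
      | zero => rw [zero_smul]; exact zero_mem _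
      | add x y _ _ hx hy => rw [add_smul]; exact add_mem hx hy
      | smul a x _ hx => rw [smul_eq_mul, mul_smul]; exact h3 _ _ hx
    have h1 : ∀ x ∈ m.map (algebraMap R A),
        KaehlerDifferential.D R A x ∈ m • (⊤ : Submodule R (Ω[A⁄R])) := by
      intro x hx
      induction hx using Submodule.span_induction with
      | mem x hx =>
        obtain ⟨r, -, rfl⟩ := hx
        rw [Derivation.map_algebraMap]
        exact zero_mem _
      | zero => rw [map_zero]; exact zero_mem _
      | add x y _ _ hx hy => rw [map_add]; exact add_mem hx hy
      | smul a x hx' hx =>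
        rw [smul_eq_mul, Derivation.leibniz]
        exact add_mem (h3 _ _ hx) (h4 _ _ hx')
    have h2 (a : A) : KaehlerDifferential.D R A a ∈ m • (⊤ : Submodule R (Ω[A⁄R])) := by
      have ha : a ∈ Submodule.span R {e : A | e * e - e ∈ m.map (algebraMap R A)} :=
        h m hm ▸ trivial
      induction ha using Submodule.span_induction with
      | mem e he =>
        have h5 := h1 _ he
        rw [map_sub, Derivation.leibniz] at h5
        have h6 := h3 (2 * e - 1) _ h5
        have h7 := h4 _ (4 • KaehlerDifferential.D R A e) he
        -- Here `D(e² - e) = (2e - 1) De` and `(2e - 1)² = 1 + 4(e² - e)`, so multiplying by `2e -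
        -- 1` recovers `De` up to a multiple of `e² - e`.
        have : KaehlerDifferential.D R A e = (2 * e - 1) • (e • KaehlerDifferential.D R A e +
          e • KaehlerDifferential.D R A e - KaehlerDifferential.D R A e) -
            (e * e - e) • (4 • KaehlerDifferential.D R A e) := by
          module
        rw [this]
        exact sub_mem h6 h7
      | zero => simp
      | add x y _ _ hx hy => rw [map_add]; exact add_mem hx hy
      | smul r x _ hx => rw [Derivation.map_smul]; exact Submodule.smul_mem _ _ hx
    rintro w -
    have hw : w ∈ Submodule.span A (Set.range (KaehlerDifferential.D R A)) :=
      KaehlerDifferential.span_range_derivation R A ▸ trivial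
    induction hw using Submodule.span_induction with
    | mem w hw => obtain ⟨a, rfl⟩ := hw; exact h2 a
    | zero => exact zero_mem _
    | add x y _ _ hx hy => exact add_mem hx hy
    | smul r x _ hx => exact h3 _ _ hx
  -- If `Ω` is nonzero, its annihilator lies in some maximal ideal `m`. Nakayama yields an
  -- annihilating element congruent to `1` modulo `m`, a contradiction.
  by_contra hne
  rw [not_subsingleton_iff_nontrivial] at hne
  obtain ⟨m, hm, hle⟩ := (Module.annihilator R (Ω[A⁄R])).exists_le_maximal fun h0 ↦ by
    rw [Module.annihilator_eq_top_iff] at h0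
    exact not_subsingleton _ h0
  obtain ⟨r, hr, hr0⟩ := Submodule.exists_sub_one_mem_and_smul_eq_zero_of_fg_of_le_smul m ⊤
    Module.Finite.fg_top (key m hm)
  have h1 : r ∈ m := hle (Module.mem_annihilator.mpr fun w ↦ hr0 w trivial)
  exact hm.ne_top ((Ideal.eq_top_iff_one m).mpr (by simpa using sub_mem h1 hr))

/-! ### Closed points of affine open sets -/

lemma ker_evalAt {U : X.Opens} (hU : IsAffineOpen U) (x : X) (hx : x ∈ U) :
    RingHom.ker (evalAt x U hx) = (hU.primeIdealOf ⟨x, hx⟩).asIdeal := by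
  ext r
  have h1 : x ∈ X.basicOpen r ↔ hU.primeIdealOf ⟨x, hx⟩ ∈ PrimeSpectrum.basicOpen r := by
    rw [← hU.fromSpec_preimage_basicOpen]
    refine Iff.trans ?_ (Scheme.Hom.mem_preimage _).symm
    rw [hU.fromSpec_primeIdealOf ⟨x, hx⟩]
  rw [RingHom.mem_ker, ← not_iff_not, ← ne_eq, evalAt_ne_zero_iff, h1]
  rfl

lemma isMaximal_ker_evalAt {U : X.Opens} (hU : IsAffineOpen U) (x : X) (hx : x ∈ U)
    (hc : IsClosed ({x} : Set X)) : (RingHom.ker (evalAt x U hx)).IsMaximal := by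
  rw [ker_evalAt hU]
  exact hU.primeIdealOf_isMaximal_of_isClosed ⟨x, hx⟩ hc

/-- A maximal ideal is a closed point of the affine open set `U`, and in a Jacobson space points
closed in an open subset are closed in the whole space. -/
lemma exists_ker_evalAt_eq [JacobsonSpace X] {U : X.Opens} (hU : IsAffineOpen U)
    (m : Ideal Γ(X, U)) (hm : m.IsMaximal) :
    ∃ (x : X) (hx : x ∈ U), IsClosed ({x} : Set X) ∧ RingHom.ker (evalAt x U hx) = m := by
  let p : PrimeSpectrum Γ(X, U) := ⟨m, hm.isPrime⟩
  have hp : IsClosed ({p} : Set (PrimeSpectrum Γ(X, U))) :=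
    (PrimeSpectrum.isClosed_singleton_iff_isMaximal p).mpr hm
  have hpU : hU.fromSpec p ∈ U := by
    have : hU.fromSpec p ∈ Set.range hU.fromSpec := ⟨p, rfl⟩
    rwa [hU.range_fromSpec] at this
  have hpc : IsClosed ({hU.fromSpec p} : Set X) := by
    have h1 := hU.fromSpec.isOpenEmbedding.preimage_closedPoints
    have h2 : p ∈ closedPoints (Spec Γ(X, U)) := hp
    rw [← h1] at h2
    exact h2
  refine ⟨hU.fromSpec p, hpU, hpc, ?_⟩
  rw [ker_evalAt hU]
  have h3 : hU.primeIdealOf ⟨hU.fromSpec p, hpU⟩ = p :=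
    hU.fromSpec.injective (hU.fromSpec_primeIdealOf _)
  rw [h3]

/-- A germ is a fraction `a / s`. The kernel of evaluation is maximal at a closed point, so `s` has
an inverse `t` modulo it, and `a * t` has the required value. -/
lemma evalAt_surjective {U : X.Opens} (hU : IsAffineOpen U) (x : X) (hx : x ∈ U)
    (hc : IsClosed ({x} : Set X)) : Function.Surjective (evalAt x U hx) := by
  intro c
  obtain ⟨g, rfl⟩ := IsLocalRing.residue_surjective c
  let := TopCat.Presheaf.algebra_section_stalk X.presheaf (⟨x, hx⟩ : U)
  have := hU.isLocalization_stalk ⟨x, hx⟩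
  obtain ⟨⟨a, s⟩, has⟩ := IsLocalization.surj (hU.primeIdealOf ⟨x, hx⟩).asIdeal.primeCompl g
  have has' : g * X.presheaf.germ U x hx s.1 = X.presheaf.germ U x hx a := has
  have h1 := congrArg (IsLocalRing.residue (X.presheaf.stalk x)) has'
  rw [map_mul, ← evalAt_apply, ← evalAt_apply] at h1
  have hm := isMaximal_ker_evalAt hU x hx hc
  have hs : s.1 ∉ RingHom.ker (evalAt x U hx) := by
    rw [ker_evalAt hU]
    exact s.2
  obtain ⟨t, ht⟩ := hm.exists_inv hs
  obtain ⟨i, hi, hti⟩ := ht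
  have h2 : evalAt x U hx t * evalAt x U hx s.1 = 1 := by
    rw [← map_mul, ← map_one (evalAt x U hx), ← hti, map_add, (RingHom.mem_ker).mp hi, add_zero]
  refine ⟨a * t, ?_⟩
  rw [map_mul, ← h1, mul_assoc, mul_comm (evalAt x U hx s.1), h2, mul_one]

/-! ### Values of sections of a bundle with a frame -/

lemma IsFrame.eq_sum_of_value_eq_zero {d : ℕ} {E : X.Modules} {U : X.Opens} {e : Fin d → Γ(E, U)}
    (he : IsFrame E U e) (x : X) (hx : x ∈ U) (s : Γ(E, U)) (hs : value E x U hx s = 0) :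
    ∃ c : Fin d → Γ(X, U), s = ∑ i, c i • e i ∧ ∀ i, evalAt x U hx (c i) = 0 := by
  obtain ⟨c, rfl⟩ := he.exists_coord s
  refine ⟨c, rfl, ?_⟩
  rw [value_sum_smul] at hs
  simp_rw [← he.fiberBasis_apply x hx] at hs
  exact Fintype.linearIndependent_iff.mp (he.fiberBasis x hx).linearIndependent _ hs

lemma IsFrame.value_surjective {d : ℕ} {E : X.Modules} {U : X.Opens} {e : Fin d → Γ(E, U)}
    (he : IsFrame E U e) (hU : IsAffineOpen U) (x : X) (hx : x ∈ U) (hc : IsClosed ({x} : Set X)) :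
    Function.Surjective (value E x U hx) := by
  intro v
  choose c hc using fun i ↦ evalAt_surjective hU x hx hc ((he.fiberBasis x hx).repr v i)
  refine ⟨∑ i, c i • e i, ?_⟩
  rw [value_sum_smul]
  simp_rw [← he.fiberBasis_apply x hx, hc]
  exact (he.fiberBasis x hx).sum_repr v

lemma value_sub (E : X.Modules) (x : X) (U : X.Opens) (hx : x ∈ U) (s t : Γ(E, U)) :
    value E x U hx (s - t) = value E x U hx s - value E x U hx t := by
  rw [value, map_sub, TensorProduct.tmul_sub]
  rfl

/-- The projections to the lines of the diagonalizing basis belong to `A`, and every diagonal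
endomorphism is a combination of them. -/
lemma IsCartanSubalgebra.mem_span_idempotent {K V : Type*} [Field K] [AddCommGroup V] [Module K V]
    {A : Submodule K (Module.End K V)} (hA : IsCartanSubalgebra A) {a : Module.End K V}
    (ha : a ∈ A) : a ∈ Submodule.span K {e | e ∈ A ∧ e * e = e} := by
  obtain ⟨n, b, hb⟩ := hA.exists_basis
  let ε (i : Fin n) : Module.End K V :=
    (LinearMap.toMatrix b b).symm (Matrix.diagonal (Pi.single i 1))
  have hε (i : Fin n) : ε i ∈ A ∧ ε i * ε i = ε i := by
    constructor
    · rw [hb, LinearEquiv.apply_symm_apply]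
      exact Matrix.isDiag_diagonal _
    · refine (LinearMap.toMatrix b b).injective ?_
      rw [LinearMap.toMatrix_mul, LinearEquiv.apply_symm_apply, Matrix.diagonal_mul_diagonal]
      congr 1
      ext j
      rw [← Pi.mul_apply, ← Pi.single_mul, mul_one]
  have h : a = ∑ i, LinearMap.toMatrix b b a i i • ε i := by
    refine (LinearMap.toMatrix b b).injective ?_
    rw [map_sum]
    simp_rw [map_smul, ε, LinearEquiv.apply_symm_apply]
    rw [← ((hb a).mp ha).diagonal_diag]
    ext i j
    simp only [Matrix.sum_apply, Matrix.smul_apply, Matrix.diagonal_apply, Matrix.diag_apply,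
      smul_eq_mul, Pi.single_apply]
    by_cases hij : i = j <;> simp [hij]
  rw [h]
  exact Submodule.sum_mem _ fun i _ ↦ Submodule.smul_mem _ _ (Submodule.subset_span (hε i))

/-! ### Étaleness of the algebra of a bundle of Cartan subalgebras -/

section CartanRing

variable [JacobsonSpace X] [IsReduced X] {d : ℕ} {E : X.Modules} (hE : IsVectorBundle d E)
  {α : E ⟶ endSheaf E} (hα : IsCartan α)

/-- In a frame, a section with zero value at `x` has coordinates vanishing at `x`. This translates
equations in the fibre into congruences modulo the ideal of `x`. -/
lemma cartanEquiv_mem_map {U : X.Opens} {e : Fin d → Γ(E, U)} (he : IsFrame E U e) (x : X)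
    (hx : x ∈ U) (s : Γ(E, U)) (hs : value E x U hx s = 0) :
    cartanEquiv hE hα U s ∈ (RingHom.ker (evalAt x U hx)).map (cartanUnit hE hα U) := by
  obtain ⟨c, rfl, hc⟩ := he.eq_sum_of_value_eq_zero x hx s hs
  rw [map_sum]
  refine Ideal.sum_mem _ fun i _ ↦ ?_
  rw [cartanEquiv_smul]
  exact Ideal.mul_mem_right _ _ (Ideal.mem_map_of_mem _ (hc i))

lemma action_eq_mul_sub {U : X.Opens} {s u : Γ(E, U)}
    (h : cartanEquiv hE hα U u =
      cartanEquiv hE hα U s * cartanEquiv hE hα U s - cartanEquiv hE hα U s) :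
    action α U u = action α U s * action α U s - action α U s :=
  Subtype.ext (congrArg (Subtype.val : cartanSubring hE hα U → _) h)

/-- Idempotents of the Cartan subalgebra at `x` lift to sections which are idempotent modulo the
ideal of `x`: the section `s² - s` acts as zero in the fibre, so its value vanishes by injectivity.
Scalars from the residue field lift to functions. -/
lemma exists_mem_span_idempotent {U : X.Opens} (hU : IsAffineOpen U) {e : Fin d → Γ(E, U)}
    (he : IsFrame E U e) (x : X) (hx : x ∈ U) (hc : IsClosed ({x} : Set X)) (S : Set Γ(E, U))
    (hS : ∀ s, s ∈ S ↔ cartanEquiv hE hα U s * cartanEquiv hE hα U s - cartanEquiv hE hα U s ∈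
      (RingHom.ker (evalAt x U hx)).map (cartanUnit hE hα U))
    {f : Module.End (IsLocalRing.ResidueField (X.presheaf.stalk x)) (Fiber E x)}
    (hf : f ∈ fiberImage α x) :
    ∃ s ∈ Submodule.span Γ(X, U) S, fiberAction α x (value E x U hx s) = f := by
  have hf' := (hα x hc).mem_span_idempotent hf
  clear hf
  induction hf' using Submodule.span_induction with
  | mem f hf =>
    obtain ⟨⟨v, hv⟩, hff⟩ := hf
    obtain ⟨s, rfl⟩ := he.value_surjective hU x hx hc v
    replace hv : fiberAction α x (value E x U hx s) = f := hv
    refine ⟨s, Submodule.subset_span ((hS s).mpr ?_), hv⟩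
    obtain ⟨u, hu⟩ := (cartanEquiv hE hα U).surjective
      (cartanEquiv hE hα U s * cartanEquiv hE hα U s - cartanEquiv hE hα U s)
    rw [← hu]
    refine cartanEquiv_mem_map hE hα he x hx u (hα.fiberAction_injective hE x hc ?_)
    rw [fiberAction_value] at hv
    rw [fiberAction_value, action_eq_mul_sub hE hα hu, endEval_sub, endEval_mul, hv, map_zero]
    exact sub_eq_zero.mpr hff
  | zero => exact ⟨0, zero_mem _, by rw [value_zero, map_zero]⟩
  | add f g _ _ hf hg =>
    obtain ⟨s, hs, rfl⟩ := hf
    obtain ⟨t, ht, rfl⟩ := hg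
    exact ⟨s + t, add_mem hs ht, by rw [value_add, map_add]⟩
  | smul c f _ hf =>
    obtain ⟨s, hs, rfl⟩ := hf
    obtain ⟨r, rfl⟩ := evalAt_surjective hU x hx hc c
    exact ⟨r • s, Submodule.smul_mem _ _ hs, by rw [value_smul, map_smul]⟩

/-- The frame makes the algebra finite free, hence flat and finitely presented. For unramifiedness,
every maximal ideal is the ideal of a closed point `x`, and each section differs from a combination
of idempotents modulo this ideal by a section vanishing at `x`. -/
lemma cartanUnit_etale_and_finite {U : X.Opens} (hU : IsAffineOpen U) {e : Fin d → Γ(E, U)}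
    (he : IsFrame E U e) : (cartanUnit hE hα U).Etale ∧ (cartanUnit hE hα U).Finite := by
  let := (cartanUnit hE hα U).toAlgebra
  let φ : Γ(E, U) ≃ₗ[Γ(X, U)] cartanSubring hE hα U :=
    { cartanEquiv hE hα U with
      map_smul' r s := (cartanEquiv_smul hE hα U r s).trans (Algebra.smul_def r _).symm }
  have hfin : Module.Finite Γ(X, U) (cartanSubring hE hα U) :=
    .of_basis ((he.basis le_rfl).map φ)
  have hfree : Module.Free Γ(X, U) (cartanSubring hE hα U) :=
    .of_basis ((he.basis le_rfl).map φ)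
  have hunr : Algebra.FormallyUnramified Γ(X, U) (cartanSubring hE hα U) := by
    refine formallyUnramified_of_span_idempotent fun m hm ↦ ?_
    obtain ⟨x, hx, hc, rfl⟩ := exists_ker_evalAt_eq hU m hm
    rw [eq_top_iff]
    rintro a -
    obtain ⟨s, rfl⟩ := φ.surjective a
    obtain ⟨t, ht, hts⟩ := exists_mem_span_idempotent hE hα hU he x hx hc
      {s | cartanEquiv hE hα U s * cartanEquiv hE hα U s - cartanEquiv hE hα U s ∈
        (RingHom.ker (evalAt x U hx)).map (cartanUnit hE hα U)} (fun s ↦ Iff.rfl)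
      ⟨value E x U hx s, rfl⟩
    have h1 : value E x U hx (s - t) = 0 := by
      refine hα.fiberAction_injective hE x hc ?_
      rw [value_sub, map_sub, hts, map_zero]
      exact sub_self _
    have h2 := cartanEquiv_mem_map hE hα he x hx _ h1
    rw [← sub_add_cancel s t, map_add]
    refine add_mem (Submodule.subset_span ?_) ?_
    · exact sub_mem (Ideal.mul_mem_left _ _ h2) h2
    · have h3 := Submodule.mem_map_of_mem (f := φ.toLinearMap) ht
      rw [Submodule.map_span] at h3
      refine Submodule.span_mono ?_ h3
      rintro _ ⟨s, hs, rfl⟩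
      exact hs
  have : Module.FinitePresentation Γ(X, U) (cartanSubring hE hα U) :=
    Module.finitePresentation_of_projective _ _
  have hflat : Module.Flat Γ(X, U) (cartanSubring hE hα U) := @Module.Flat.of_free _ _ _ _ _ hfree
  have : Algebra.Etale Γ(X, U) (cartanSubring hE hα U) := .of_formallyUnramified_of_flat
  exact ⟨this, hfin⟩

end CartanRing

/-- A bundle of Cartan subalgebras is the direct image of the structure sheaf of an étale
covering. -/
theorem IsCartan.exists_isEtaleCovering [JacobsonSpace X] [IsReduced X] {d : ℕ} {E : X.Modules}
    (hE : IsVectorBundle d E) {α : E ⟶ endSheaf E} (hα : IsCartan α) :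
    ∃ (Y : Scheme.{u}) (f : Y ⟶ X), IsEtaleCovering f ∧
      Nonempty (directImageStructureSheaf f ≅ E) := by
  obtain ⟨Y, f, hf, θ, hθ, hiso⟩ := (hα.algebraData hE).exists_isAffineHom hE
  have key (U : X.Opens) (hU : IsAffineOpen U) {e : Fin d → Γ(E, U)} (he : IsFrame E U e) :
      (f.app U).hom.Etale ∧ (f.app U).hom.Finite := by
    have h := cartanUnit_etale_and_finite hE hα hU he
    have h1 : (f.app U).hom = (θ U).toRingHom.comp (cartanUnit hE hα U) :=
      RingHom.ext fun r ↦ (hθ U r).symm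
    rw [h1]
    exact ⟨RingHom.Etale.respectsIso.1 _ (θ U) h.1, RingHom.finite_respectsIso.1 _ (θ U) h.2⟩
  choose V hxV e he using fun x ↦ hE.exists_isFrame x
  have hex (x : X) : ∃ U : X.Opens, IsAffineOpen U ∧ x ∈ U ∧ U ≤ V x := by
    obtain ⟨_, ⟨U, hU, rfl⟩, hxU, hUV⟩ :=
      X.isBasis_affineOpens.exists_subset_of_mem_open (hxV x) (V x).2
    exact ⟨U, hU, hxU, hUV⟩
  choose W hW hxW hWV using hex
  have htop : ⨆ x, W x = ⊤ := eq_top_iff.mpr fun x _ ↦ Opens.mem_iSup.mpr ⟨x, hxW x⟩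
  have hAff (x : X) : IsAffine (W x) := hW x
  have hAff' (x : X) : IsAffine (f ⁻¹ᵁ W x) := (hW x).preimage f
  -- Being finite and being étale are local on the target, so it is enough to treat the restrictions
  -- of `f` over affine open sets with a frame, where they can be read off from the map of rings.
  have happ (x : X) : (f ∣_ W x).appTop.hom.Etale ∧ (f ∣_ W x).appTop.hom.Finite := by
    have hWx : (W x).ι ''ᵁ ⊤ = W x := by simp
    have h := key ((W x).ι ''ᵁ ⊤) (hWx.symm ▸ hW x) ((he x).restrict (hWx.le.trans (hWV x)))
    let ι := (Y.presheaf.mapIso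
      (eqToIso (image_morphismRestrict_preimage f (W x) ⊤)).op).commRingCatIsoToRingEquiv
    have h1 : (f ∣_ W x).appTop.hom = ι.toRingHom.comp (f.app ((W x).ι ''ᵁ ⊤)).hom :=
      congrArg CommRingCat.Hom.hom (morphismRestrict_appTop f (W x))
    have h2 := RingHom.Etale.respectsIso.1 _ ι h.1
    have h3 := RingHom.finite_respectsIso.1 _ ι h.2
    exact ⟨h1 ▸ h2, h1 ▸ h3⟩
  refine ⟨Y, f, ⟨?_, ?_⟩, hiso⟩
  · let hfin :=
      IsFinite.instHasAffinePropertyAndIsAffineFiniteCarrierObjOppositeOpensCarrierCarrierCommRingCatPresheafOpOpensTopHomAppTop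
    exact (hfin.iff_of_iSup_eq_top (fun x ↦ ⟨W x, hW x⟩) htop).mpr fun x ↦ ⟨hAff' x, (happ x).2⟩
  · refine (@IsZariskiLocalAtTarget.iff_of_iSup_eq_top @Etale.{u}
      (HasRingHomProperty.instIsZariskiLocalAtTarget _ (Q := RingHom.Etale)) _ _ _ _ W htop).mpr
        fun x ↦ ?_
    exact (HasRingHomProperty.iff_of_isAffine (P := @Etale.{u})).mpr (happ x).1

/-! ### The bundle of Cartan subalgebras of an étale covering -/

/-- An étale algebra over a separably closed field acts on itself by a Cartan subalgebra. -/
lemma isCartanSubalgebra_range_of_mul {K V T : Type*} [Field K] [IsSepClosed K] [AddCommGroup V]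
    [Module K V] [CommRing T] [Algebra K T] [Module.Finite K T] [Algebra.FormallyEtale K T]
    (Φ : T ≃ₗ[K] V) (L : V →ₗ[K] Module.End K V) (h : ∀ a b, L (Φ a) (Φ b) = Φ (a * b)) :
    IsCartanSubalgebra (LinearMap.range L) := by
  -- An element is recovered from its action by applying it to the unit.
  have hL : Function.Injective L := by
    intro v w hvw
    obtain ⟨a, rfl⟩ := Φ.surjective v
    obtain ⟨b, rfl⟩ := Φ.surjective w
    have := congrArg (fun l ↦ l (Φ 1)) hvw
    simpa only [h, mul_one] using this
  refine ⟨LinearMap.finrank_range_of_inj hL, ?_⟩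
  have hfin : Finite (PrimeSpectrum T) := by
    have := IsArtinianRing.of_finite K T
    infer_instance
  -- Over a separably closed field `T` is a finite product of copies of `K`. The standard
  -- idempotents, transported to `V`, are common eigenvectors of all multiplications.
  let e := Algebra.FormallyEtale.equivPiOfIsSepClosed K T
  have := Fintype.ofFinite (PrimeSpectrum T)
  classical
  let ε := Fintype.equivFin (PrimeSpectrum T)
  let b : Module.Basis (Fin (Fintype.card (PrimeSpectrum T))) K V :=
    (((Pi.basisFun K (PrimeSpectrum T)).map e.symm.toLinearEquiv).map Φ).reindex ε
  have hb (j) : b j = Φ (e.symm (Pi.single (ε.symm j) 1)) := by simp [b]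
  refine ⟨_, b, ?_⟩
  rintro _ ⟨v, rfl⟩
  obtain ⟨a, rfl⟩ := Φ.surjective v
  intro i j hij
  have h1 : a * e.symm (Pi.single (ε.symm j) 1) =
      e a (ε.symm j) • e.symm (Pi.single (ε.symm j) 1) := by
    apply e.injective
    rw [map_mul, AlgEquiv.apply_symm_apply, map_smul, AlgEquiv.apply_symm_apply]
    ext k
    by_cases hk : k = ε.symm j
    · subst hk; simp
    · simp [Pi.single_eq_of_ne hk]
  rw [LinearMap.toMatrix_apply, hb, h, h1, map_smul, ← hb, map_smul, Module.Basis.repr_self]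
  simp [hij.symm]

/-! ### The action of a sheaf of algebras on itself -/

namespace AlgebraData

variable {E : X.Modules} (A : AlgebraData E)

/-- Multiplication by a section of a sheaf of algebras. -/
def mulSections (U : X.Opens) : Γ(E, U) →+ endSections E U where
  toFun s := ⟨fun V ↦
    { toFun t := (A.equiv V.1).symm
        (A.equiv V.1 (E.presheaf.map (homOfLE V.2).op s) * A.equiv V.1 t)
      map_add' t t' := by rw [map_add, mul_add, map_add]
      map_smul' r t := (A.equiv V.1).injective (by
        rw [RingHom.id_apply, A.equiv_smul, A.equiv_smul, AddEquiv.apply_symm_apply,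
          AddEquiv.apply_symm_apply, mul_left_comm]) }, fun V W h t ↦ (A.equiv W.1).injective (by
        refine (A.equiv_map h _).trans ?_
        refine Eq.trans ?_ (AddEquiv.apply_symm_apply _ _).symm
        refine (congrArg _ (AddEquiv.apply_symm_apply _ _)).trans ?_
        rw [map_mul, ← A.equiv_map, ← A.equiv_map, mmap_comp])⟩
  map_zero' := Subtype.ext <| funext fun V ↦ LinearMap.ext fun t ↦ (A.equiv V.1).injective (by
    refine (AddEquiv.apply_symm_apply _ _).trans ?_
    rw [map_zero, map_zero, zero_mul]
    exact (map_zero (A.equiv V.1)).symm)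
  map_add' s s' := Subtype.ext <| funext fun V ↦ LinearMap.ext fun t ↦ by
    change (A.equiv V.1).symm _ = (A.equiv V.1).symm _ + (A.equiv V.1).symm _
    rw [← map_add, ← add_mul, map_add, map_add]

lemma mulSections_apply (U : X.Opens) (s : Γ(E, U)) (V : {V : X.Opens // V ≤ U}) (t : Γ(E, V.1)) :
    (A.mulSections U s).1 V t = (A.equiv V.1).symm
      (A.equiv V.1 (E.presheaf.map (homOfLE V.2).op s) * A.equiv V.1 t) := rfl

/-- A sheaf of algebras acts on itself by multiplication. -/
def mulHom : E ⟶ endSheaf E :=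
  homOfSections A.mulSections
    (fun {U V} h s ↦ Subtype.ext <| funext fun W ↦ LinearMap.ext fun t ↦ by
      refine (congrArg (fun s ↦ (A.equiv W.1).symm (A.equiv W.1 s * A.equiv W.1 t))
        (mmap_comp E h W.2 s)).trans ?_
      rfl)
    (fun U r s ↦ Subtype.ext <| funext fun V ↦ LinearMap.ext fun t ↦ (A.equiv V.1).injective (by
      refine (AddEquiv.apply_symm_apply _ _).trans ?_
      refine Eq.trans ?_ (A.equiv_smul V.1 (X.presheaf.map (homOfLE V.2).op r) _).symm
      refine Eq.trans ?_ (congrArg _ (AddEquiv.apply_symm_apply _ _).symm)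
      rw [Scheme.Modules.map_smul, A.equiv_smul, mul_assoc]))

lemma fiberAction_value_value (x : X) (U : X.Opens) (hx : x ∈ U) (s t : Γ(E, U)) :
    fiberAction A.mulHom x (value E x U hx s) (value E x U hx t) =
      value E x U hx ((A.equiv U).symm (A.equiv U s * A.equiv U t)) := by
  rw [fiberAction_value, endEval_value E x U hx _ U hx le_rfl]
  congr 1
  refine (A.mulSections_apply U s ⟨U, le_rfl⟩ t).trans ?_
  rw [mmap_self]

/-- Multiplication by `v` sends the value of the unit section to `v`, so `v` is determined by its
action. This holds at every point, closed or not. -/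
lemma fiberMap_mulHom_injective (x : X) : Function.Injective (fiberMap A.mulHom x) := by
  suffices h : Function.Injective (fiberAction A.mulHom x) from
    Function.Injective.of_comp (f := endFiberMap E x) h
  let u := (A.equiv ⊤).symm 1
  have key (v : Fiber E x) : fiberAction A.mulHom x v (value E x ⊤ trivial u) = v := by
    refine fiber_induction E x ⊤ trivial
      (p := fun v ↦ fiberAction A.mulHom x v (value E x ⊤ trivial u) = v) (by simp)
      (fun v w hv hw ↦ by rw [map_add, LinearMap.add_apply, hv, hw])
      (fun c v hv ↦ by rw [map_smul, LinearMap.smul_apply, hv]) (fun V hV hVU s ↦ ?_) v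
    rw [← value_restrict E hVU hV, fiberAction_value_value, A.equiv_map, AddEquiv.apply_symm_apply,
      map_one, mul_one, AddEquiv.symm_apply_apply]
  intro v w hvw
  rw [← key v, ← key w, hvw]

/-- The frame identifies the fibre with the base change of `A.ring` over `U` to the residue field,
compatibly with multiplication. Étaleness is stable under base change, so
`isCartanSubalgebra_range_of_mul` applies. -/
lemma isCartanSubalgebra_fiberImage {d : ℕ} {U : X.Opens} {e : Fin d → Γ(E, U)}
    (he : IsFrame E U e) (x : X) (hx : x ∈ U)
    [IsSepClosed (IsLocalRing.ResidueField (X.presheaf.stalk x))]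
    (hA : (A.unit.app (op U)).hom.Etale) : IsCartanSubalgebra (fiberImage A.mulHom x) := by
  let := (evalAt x U hx).toAlgebra
  let := (A.unit.app (op U)).hom.toAlgebra
  have : Algebra.Etale Γ(X, U) (A.ring.obj (op U)) := hA
  let φ : Γ(E, U) ≃ₗ[Γ(X, U)] A.ring.obj (op U) :=
    { A.equiv U with
      map_smul' r s := (A.equiv_smul U r s).trans (Algebra.smul_def r _).symm }
  let b := (he.basis le_rfl).map φ
  have hb (i) : b i = A.equiv U (e i) := by
    change A.equiv U (he.basis le_rfl i) = _
    rw [he.basis_apply, mmap_self]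
  let bT := b.baseChange (IsLocalRing.ResidueField (X.presheaf.stalk x))
  have := Module.Finite.of_basis bT
  let Φ := bT.equiv (he.fiberBasis x hx) (Equiv.refl _)
  have hΦb (i) : Φ (1 ⊗ₜ b i) = value E x U hx (e i) := by
    rw [← Module.Basis.baseChange_apply, Module.Basis.equiv_apply, Equiv.refl_apply,
      he.fiberBasis_apply]
  have hΦ (s : Γ(E, U)) : Φ (1 ⊗ₜ A.equiv U s) = value E x U hx s := by
    obtain ⟨c, rfl⟩ := he.exists_coord s
    rw [value_sum_smul, map_sum, TensorProduct.tmul_sum, map_sum]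
    refine Finset.sum_congr rfl fun i _ ↦ ?_
    rw [A.equiv_smul, ← hΦb, ← map_smul, hb]
    congr 1
    have h1 : A.unit.app (op U) (c i) * A.equiv U (e i) = c i • A.equiv U (e i) :=
      (Algebra.smul_def (c i) (A.equiv U (e i))).symm
    rw [h1, ← TensorProduct.smul_tmul, TensorProduct.smul_tmul', Algebra.smul_def]
    rfl
  refine isCartanSubalgebra_range_of_mul Φ (fiberAction A.mulHom x) fun a c ↦ ?_
  let l₁ := (fiberAction A.mulHom x).compl₁₂ Φ.toLinearMap Φ.toLinearMap
  let l₂ := (LinearMap.mul (IsLocalRing.ResidueField (X.presheaf.stalk x))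
    (IsLocalRing.ResidueField (X.presheaf.stalk x) ⊗[Γ(X, U)] A.ring.obj (op U))).compr₂
      Φ.toLinearMap
  suffices h : l₁ = l₂ from LinearMap.congr_fun₂ h a c
  refine bT.ext fun i ↦ bT.ext fun j ↦ ?_
  change fiberAction A.mulHom x (Φ (bT i)) (Φ (bT j)) = Φ (bT i * bT j)
  rw [Module.Basis.baseChange_apply, Module.Basis.baseChange_apply, hΦb, hΦb,
    fiberAction_value_value, Algebra.TensorProduct.tmul_mul_tmul, one_mul, hb, hb, ← hΦ,
    AddEquiv.apply_symm_apply]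

/-- The sheaf of algebras given by a morphism of schemes. -/
def ofIso {Y : Scheme.{u}} (f : Y ⟶ X) (φ : directImageStructureSheaf f ≅ E) : AlgebraData E where
  ring := (Opens.map f.base).op ⋙ Y.presheaf
  unit := f.c
  equiv U := ((Scheme.Modules.Hom.isIso_iff_isIso_app.mp φ.isIso_inv U) |> fun _ ↦
    (asIso (φ.inv.app U)).addCommGroupIsoToAddEquiv)
  equiv_map := Hom.app_map φ.inv
  equiv_smul _ r s := Scheme.Modules.Hom.app_smul φ.inv r s

end AlgebraData

/-! ### Étale coverings -/

lemma IsEtaleCovering.app_etale {Y : Scheme.{u}} {f : Y ⟶ X} (hf : IsEtaleCovering f) {U : X.Opens}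
    (hU : IsAffineOpen U) : IsAffineOpen (f ⁻¹ᵁ U) ∧ (f.app U).hom.Etale := by
  have := hf.etale
  have := hf.isFinite
  have hV : IsAffineOpen (f ⁻¹ᵁ U) := hU.preimage f
  refine ⟨hV, ?_⟩
  have h := f.etale_appLE hU hV le_rfl
  rwa [Scheme.Hom.appLE_eq_app] at h

/-- The direct image of the structure sheaf of an étale covering is a bundle of Cartan
subalgebras. -/
lemma IsEtaleCovering.isCartan_mulHom {Y : Scheme.{u}} {f : Y ⟶ X} (hf : IsEtaleCovering f)
    {d : ℕ} {E : X.Modules} (hE : IsVectorBundle d E) (φ : directImageStructureSheaf f ≅ E)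
    (hX : ∀ x : X, IsClosed ({x} : Set X) →
      IsSepClosed (IsLocalRing.ResidueField (X.presheaf.stalk x))) :
    IsCartan (AlgebraData.ofIso f φ).mulHom := by
  intro x hx
  have := hX x hx
  obtain ⟨V, hxV, e, he⟩ := hE.exists_isFrame x
  obtain ⟨_, ⟨U, hU, rfl⟩, hxU, hUV⟩ :=
    X.isBasis_affineOpens.exists_subset_of_mem_open hxV V.2
  exact (AlgebraData.ofIso f φ).isCartanSubalgebra_fiberImage (he.restrict hUV) x hxU
    (hf.app_etale hU).2

/-- An étale algebra over an integral domain is reduced. -/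
lemma isReduced_of_etale (R B : Type u) [CommRing R] [IsDomain R] [CommRing B] [Algebra R B]
    [Algebra.Etale R B] : _root_.IsReduced B := by
  -- By flatness `B` embeds in its base change to the fraction field, which is étale over a field
  -- and hence reduced.
  have h1 : Function.Injective
      (Algebra.TensorProduct.includeRight : B →ₐ[R] FractionRing R ⊗[R] B) :=
    Algebra.TensorProduct.includeRight_injective (IsFractionRing.injective R (FractionRing R))
  have := Algebra.FormallyUnramified.isReduced_of_field (FractionRing R) (FractionRing R ⊗[R] B)
  exact isReduced_of_injective _ h1

lemma IsEtaleCovering.isReduced {Y : Scheme.{u}} {f : Y ⟶ X} (hf : IsEtaleCovering f)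
    [IsIntegral X] : IsReduced Y := by
  have (y : Y) : _root_.IsReduced (Y.presheaf.stalk y) := by
    obtain ⟨_, ⟨U, hU, rfl⟩, hyU, -⟩ :=
      X.isBasis_affineOpens.exists_subset_of_mem_open (Set.mem_univ (f y)) isOpen_univ
    obtain ⟨hV, h⟩ := hf.app_etale hU
    have : Nonempty U := ⟨⟨f y, hyU⟩⟩
    let := (f.app U).hom.toAlgebra
    have : Algebra.Etale Γ(X, U) Γ(Y, f ⁻¹ᵁ U) := h
    have := isReduced_of_etale Γ(X, U) Γ(Y, f ⁻¹ᵁ U)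
    let := TopCat.Presheaf.algebra_section_stalk Y.presheaf (⟨y, hyU⟩ : (f ⁻¹ᵁ U : Y.Opens))
    have := hV.isLocalization_stalk ⟨y, hyU⟩
    exact isReduced_localizationPreserves (hV.primeIdealOf ⟨y, hyU⟩).asIdeal.primeCompl _ ‹_›
  exact isReduced_of_isReduced_stalk Y

/-- A finite morphism has closed image. Over the open complement the direct image vanishes, whereas
a bundle of positive rank has nonzero fibres. -/
lemma IsEtaleCovering.surjective {Y : Scheme.{u}} {f : Y ⟶ X} (hf : IsEtaleCovering f)
    {d : ℕ} {E : X.Modules} (hE : IsVectorBundle d E) (φ : directImageStructureSheaf f ≅ E)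
    (hd : 0 < d) : Function.Surjective f := by
  have := hf.isFinite
  intro x
  by_contra hx
  let U : X.Opens := ⟨(Set.range f)ᶜ, f.isClosedMap.isClosed_range.isOpen_compl⟩
  have hxU : x ∈ U := fun ⟨y, hy⟩ ↦ hx ⟨y, hy⟩
  obtain ⟨V, hxV, hVU, e, he⟩ := hE.exists_isFrame_le x U hxU
  have hV : f ⁻¹ᵁ V = ⊥ := by
    rw [eq_bot_iff]
    exact fun y hy ↦ hVU hy ⟨y, rfl⟩
  have : Subsingleton Γ(Y, f ⁻¹ᵁ V) := by
    rw [hV]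
    infer_instance
  have : Subsingleton ((AlgebraData.ofIso f φ).ring.obj (op V)) := this
  have : Subsingleton Γ(E, V) := ((AlgebraData.ofIso f φ).equiv V).toEquiv.subsingleton
  have h1 := (he.fiberBasis x hxV).ne_zero ⟨0, hd⟩
  rw [he.fiberBasis_apply, Subsingleton.elim (e _) 0, value_zero] at h1
  exact h1 rfl

/-- As `f` is open and closed, every nonempty clopen subset of `Y` maps onto the connected space
`X`, so it meets each fibre, and fibres are finite. -/
lemma IsEtaleCovering.finite_connectedComponents {Y : Scheme.{u}} {f : Y ⟶ X}
    (hf : IsEtaleCovering f) [IsIntegral X] : Finite (_root_.ConnectedComponents Y) := by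
  have := hf.isFinite
  have := hf.etale
  obtain ⟨x⟩ : Nonempty X := inferInstance
  exact f.isOpenMap.finite_connectedComponents_of_finite_preimage_singleton_of_connectedSpace
    f.isClosedMap (f.finite_preimage_singleton x)

/-! ### Projective varieties -/

section Projective

variable {k : Type u} [Field k]

attribute [local instance] MvPolynomial.gradedAlgebra in
lemma algebraMap_homogeneousSubmodule_zero_bijective (n : ℕ) :
    Function.Bijective (algebraMap k (MvPolynomial.homogeneousSubmodule (Fin (n + 1)) k 0)) := by
  constructor
  · intro a b hab
    exact MvPolynomial.C_injective (Fin (n + 1)) k (congrArg Subtype.val hab)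
  · rintro ⟨q, hq⟩
    rw [MvPolynomial.mem_homogeneousSubmodule] at hq
    refine ⟨q.coeff 0, Subtype.ext ?_⟩
    exact (MvPolynomial.totalDegree_eq_zero_iff_eq_C.mp (Nat.le_zero.mp hq.totalDegree_le)).symm

attribute [local instance] MvPolynomial.gradedAlgebra in
-- `Proj` is proper over the spectrum of the degree-zero part when the graded ring is of finite type
-- over it; here the degree-zero part is `k`.
lemma isProper_projectiveSpaceToSpec (n : ℕ) : IsProper (projectiveSpaceToSpec k n) := by
  have h := algebraMap_homogeneousSubmodule_zero_bijective (k := k) n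
  have : IsIso (CommRingCat.ofHom
      (algebraMap k (MvPolynomial.homogeneousSubmodule (Fin (n + 1)) k 0))) :=
    (ConcreteCategory.isIso_iff_bijective _).mpr h
  have : IsScalarTower k (MvPolynomial.homogeneousSubmodule (Fin (n + 1)) k 0)
      (MvPolynomial (Fin (n + 1)) k) :=
    IsScalarTower.of_algebraMap_eq (R := k)
      (S := MvPolynomial.homogeneousSubmodule (Fin (n + 1)) k 0)
      (A := MvPolynomial (Fin (n + 1)) k) fun _ ↦ rfl
  have : Algebra.FiniteType (MvPolynomial.homogeneousSubmodule (Fin (n + 1)) k 0)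
      (MvPolynomial (Fin (n + 1)) k) := .of_restrictScalars_finiteType k _ _
  have h1 : IsProper (Proj.toSpecZero (MvPolynomial.homogeneousSubmodule (Fin (n + 1)) k)) :=
    inferInstance
  have h2 : IsProper (Spec.map (CommRingCat.ofHom
      (algebraMap k (MvPolynomial.homogeneousSubmodule (Fin (n + 1)) k 0)))) :=
    inferInstance
  exact MorphismProperty.comp_mem @IsProper _ _ h1 h2

lemma IsIrreducibleProjectiveVariety.isProper {p : X ⟶ Spec (.of k)}
    (hX : IsIrreducibleProjectiveVariety p) : IsProper p := by
  obtain ⟨n, i, hi, rfl⟩ := hX.isProjective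
  have := isProper_projectiveSpaceToSpec (k := k) n
  infer_instance

/-- By the Nullstellensatz the residue field at a closed point is `k` itself. -/
lemma isSepClosed_residueField [IsAlgClosed k] (p : X ⟶ Spec (.of k)) [LocallyOfFiniteType p]
    (x : X) (hx : IsClosed ({x} : Set X)) :
    IsSepClosed (IsLocalRing.ResidueField (X.presheaf.stalk x)) := by
  let e : k ≃+* IsLocalRing.ResidueField (X.presheaf.stalk x) :=
    (residueFieldIsoBase p x hx).symm.commRingCatIsoToRingEquiv
  have : IsAlgClosed (IsLocalRing.ResidueField (X.presheaf.stalk x)) :=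
    IsAlgClosed.of_ringEquiv _ _ e
  infer_instance

end Projective

/-! ### Connected components and global sections -/

section Components

variable {Y : Scheme.{u}} {k : Type u} [Field k]

lemma evalAt_eq_iff (y : Y) (s t : Γ(Y, ⊤)) :
    evalAt y ⊤ trivial s = evalAt y ⊤ trivial t ↔ y ∉ Y.basicOpen (s - t) := by
  rw [← evalAt_ne_zero_iff y ⊤ trivial, not_not, map_sub, sub_eq_zero]

lemma eq_of_evalAt_eq [IsReduced Y] (s t : Γ(Y, ⊤))
    (h : ∀ y : Y, evalAt y ⊤ trivial s = evalAt y ⊤ trivial t) : s = t := by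
  rw [← sub_eq_zero, ← basicOpen_eq_bot_iff, eq_bot_iff]
  exact fun y hy ↦ (evalAt_eq_iff y s t).mp (h y) hy

/-- A function which is integral over an algebraically closed field is constant on connected
components. -/
lemma exists_evalAt_eq_of_isIntegral [IsAlgClosed k] (κ : k →+* Γ(Y, ⊤)) (s : Γ(Y, ⊤))
    (hs : κ.IsIntegralElem s) : ∃ c : _root_.ConnectedComponents Y → k,
      ∀ y : Y, evalAt y ⊤ trivial s = evalAt y ⊤ trivial (κ (c y)) := by
  obtain ⟨q, hq, hqs⟩ := hs
  -- The polynomial `q` splits over `k`, so in every residue field its roots are the images of its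
  -- roots in `k`. Thus `s` takes finitely many values, all in `k`.
  have hroot (y : Y) : ∃ a ∈ q.roots, evalAt y ⊤ trivial s = evalAt y ⊤ trivial (κ a) := by
    have h1 : evalAt y ⊤ trivial s ∈ (q.map ((evalAt y ⊤ trivial).comp κ)).roots := by
      rw [Polynomial.mem_roots (hq.map _).ne_zero, Polynomial.IsRoot, Polynomial.eval_map,
        ← Polynomial.hom_eval₂, hqs, map_zero]
    rw [(IsAlgClosed.splits q).roots_map, Multiset.mem_map] at h1
    obtain ⟨a, ha, h⟩ := h1
    exact ⟨a, ha, h.symm⟩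
  choose a ha has using hroot
  have hfib (t : k) : IsClosed (a ⁻¹' {t}) := by
    have : a ⁻¹' {t} = ((Y.basicOpen (s - κ t) : Y.Opens) : Set Y)ᶜ := by
      ext y
      rw [Set.mem_compl_iff, SetLike.mem_coe, ← evalAt_eq_iff, has y]
      exact (((evalAt y ⊤ trivial).comp κ).injective.eq_iff (a := a y) (b := t)).symm
    rw [this]
    exact (Y.basicOpen (s - κ t)).2.isClosed_compl
  -- Each level set is the vanishing locus of `s - κ t`, hence closed. As there are finitely many
  -- values, all preimages are closed, so `a` is locally constant.
  have hclosed (T : Set k) : IsClosed (a ⁻¹' T) := by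
    classical
    have : a ⁻¹' T = ⋃ t ∈ T ∩ q.roots.toFinset, a ⁻¹' {t} := by
      ext y
      simp only [Set.mem_preimage, Set.mem_iUnion, Set.mem_singleton_iff, exists_prop,
        exists_eq_right']
      exact ⟨fun h ↦ ⟨h, by simpa using ha y⟩, fun h ↦ h.1⟩
    rw [this]
    exact (q.roots.toFinset.finite_toSet.subset Set.inter_subset_right).isClosed_biUnion
      fun t _ ↦ hfib t
  have hloc : IsLocallyConstant a := fun T ↦ by
    have := (hclosed Tᶜ).isOpen_compl
    rwa [Set.preimage_compl, compl_compl] at this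
  refine ⟨fun C ↦ a (Function.surjInv ConnectedComponents.surjective_coe C), fun y ↦ ?_⟩
  rw [has y, hloc.apply_eq_of_isPreconnected isPreconnected_connectedComponent
    mem_connectedComponent]
  rw [← ConnectedComponents.coe_eq_coe']
  exact Function.surjInv_eq ConnectedComponents.surjective_coe _

/-- Functions can be prescribed on connected components. -/
lemma exists_evalAt_eq [Finite (_root_.ConnectedComponents Y)]
    (c : _root_.ConnectedComponents Y → Γ(Y, ⊤)) :
    ∃ s : Γ(Y, ⊤), ∀ y : Y, evalAt y ⊤ trivial s = evalAt y ⊤ trivial (c y) := by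
  -- With finitely many components each one is open, so functions on the disjoint components glue.
  let U (C : _root_.ConnectedComponents Y) : Y.Opens :=
    ⟨ConnectedComponents.mk ⁻¹' {C},
      (isOpen_discrete _).preimage ConnectedComponents.continuous_coe⟩
  obtain ⟨s, hs, -⟩ := Y.sheaf.existsUnique_gluing' U ⊤ (fun C ↦ homOfLE le_top)
    (fun y _ ↦ Opens.mem_iSup.mpr ⟨y, rfl⟩) (fun C ↦ Y.presheaf.map (homOfLE le_top).op (c C))
    fun C D ↦ by
      by_cases h : C = D
      · subst h; rfl
      · have : U C ⊓ U D = ⊥ := by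
          rw [eq_bot_iff]
          rintro y ⟨h1, h2⟩
          exact h (h1.symm.trans h2)
        have : Subsingleton Γ(Y, U C ⊓ U D) := by
          rw [this]
          infer_instance
        exact this.elim _ _
  refine ⟨s, fun y ↦ ?_⟩
  have hy : y ∈ U y := rfl
  have h1 : Y.presheaf.map (homOfLE le_top).op s =
    Y.presheaf.map (homOfLE (le_top : U y ≤ ⊤)).op (c y) := hs y
  exact (evalAt_restrict (le_top : U y ≤ ⊤) hy s).symm.trans
    ((congrArg (evalAt y (U y) hy) h1).trans (evalAt_restrict (le_top : U y ≤ ⊤) hy (c y)))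

/-- If the functions on a reduced scheme are integral over an algebraically closed field, they are
the functions on the set of connected components. -/
lemma card_connectedComponents_eq_finrank [IsAlgClosed k] [IsReduced Y]
    [Finite (_root_.ConnectedComponents Y)] (κ : k →+* Γ(Y, ⊤)) (hκ : κ.IsIntegral)
    {H : Type u} [AddCommGroup H] [Module k H] (θ : H ≃+ Γ(Y, ⊤))
    (hθ : ∀ (a : k) (h : H), θ (a • h) = κ a * θ h) :
    Module.Finite k H ∧ Nat.card (_root_.ConnectedComponents Y) = Module.finrank k H := by
  choose c hc using fun h ↦ exists_evalAt_eq_of_isIntegral κ (θ h) (hκ (θ h))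
  have huniq (h : H) (c' : _root_.ConnectedComponents Y → k)
      (hc' : ∀ y : Y, evalAt y ⊤ trivial (θ h) = evalAt y ⊤ trivial (κ (c' y))) : c h = c' := by
    ext C
    obtain ⟨y, rfl⟩ := ConnectedComponents.surjective_coe C
    exact ((evalAt y ⊤ trivial).comp κ).injective ((hc h y).symm.trans (hc' y))
  let L : H →ₗ[k] (_root_.ConnectedComponents Y → k) :=
    { toFun := c
      map_add' a b := huniq _ _ fun y ↦ by
        rw [Pi.add_apply, map_add, map_add, map_add, map_add, hc, hc]
      map_smul' a b := huniq _ _ fun y ↦ by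
        rw [Pi.smul_apply, smul_eq_mul, hθ, map_mul, map_mul, map_mul, hc]
        rfl }
  -- Injectivity uses that `Y` is reduced, so a function is determined by its values; surjectivity
  -- is gluing of constants.
  have hL : Function.Bijective L := by
    constructor
    · intro a b hab
      refine θ.injective (eq_of_evalAt_eq _ _ fun y ↦ ?_)
      have : c a = c b := hab
      rw [hc, hc, this]
    · intro c'
      obtain ⟨s, hs⟩ := exists_evalAt_eq fun C ↦ κ (c' C)
      obtain ⟨h, rfl⟩ := θ.surjective s
      exact ⟨h, huniq h c' hs⟩
  let e := LinearEquiv.ofBijective L hL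
  have := Fintype.ofFinite (_root_.ConnectedComponents Y)
  refine ⟨Module.Finite.equiv e.symm, ?_⟩
  rw [e.finrank_eq, Module.finrank_fintype_fun_eq_card, Nat.card_eq_fintype_card]

end Components

/-- The connected components of a covering are counted by the global sections of the direct image
of its structure sheaf. -/
lemma IsEtaleCovering.card_connectedComponents {k : Type u} [Field k] [IsAlgClosed k]
    (p : X ⟶ Spec (.of k)) [IsProper p] [IsIntegral X] {Y : Scheme.{u}} {f : Y ⟶ X}
    (hf : IsEtaleCovering f) {E : X.Modules} (φ : directImageStructureSheaf f ≅ E) :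
    Module.Finite k (H0 p E) ∧
      Nat.card (_root_.ConnectedComponents Y) = Module.finrank k (H0 p E) := by
  have := hf.isFinite
  have := hf.isReduced
  have := hf.finite_connectedComponents
  -- `Y` is proper over `k`, and functions on a universally closed scheme over an affine base are
  -- integral over the base. Finite dimensionality of `H⁰` is then a consequence of the finiteness
  -- of the set of components.
  have hint : (f ≫ p).appTop.hom.IsIntegral := isIntegral_appTop_of_universallyClosed (f ≫ p)
  let κ₀ : k →+* Γ(X, ⊤) := ((Scheme.ΓSpecIso (.of k)).inv ≫ p.appTop).hom
  let A := AlgebraData.ofIso f φ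
  refine card_connectedComponents_eq_finrank ((f.app ⊤).hom.comp κ₀) ?_ (A.equiv ⊤)
    fun a s ↦ A.equiv_smul ⊤ (κ₀ a) s
  have h1 : (f.app ⊤).hom.comp κ₀ =
      (f ≫ p).appTop.hom.comp (Scheme.ΓSpecIso (.of k)).inv.hom := by
    rw [Scheme.Hom.comp_appTop]
    rfl
  rw [h1]
  refine RingHom.IsIntegral.trans _ _ (RingHom.isIntegral_of_surjective _ ?_) hint
  exact ((Scheme.ΓSpecIso (.of k)).symm.commRingCatIsoToRingEquiv).surjective

end CartanBundle
end

/-! ### The main theorem -/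

theorem corollary2p5 {k : Type u} [Field k] [IsAlgClosed k] {X : Scheme.{u}}
    (p : X ⟶ Spec (.of k)) (hX : CartanBundle.IsIrreducibleProjectiveVariety p)
    (d : ℕ) (E : X.Modules) (hE : CartanBundle.IsVectorBundle d E) :
    ((∃ (Y : Scheme.{u}) (f : Y ⟶ X), CartanBundle.IsEtaleCovering f ∧
        Nonempty (CartanBundle.directImageStructureSheaf f ≅ E)) ↔
      ∃ α : E ⟶ CartanBundle.endSheaf E,
        (∀ x : X, Function.Injective (CartanBundle.fiberMap α x)) ∧
        ∀ x : X, IsClosed ({x} : Set X) →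
          CartanBundle.IsCartanSubalgebra (CartanBundle.fiberImage α x)) ∧
    ∀ (Y : Scheme.{u}) (f : Y ⟶ X), CartanBundle.IsEtaleCovering f →
      Nonempty (CartanBundle.directImageStructureSheaf f ≅ E) →
      (0 < d → Function.Surjective f) ∧
      Finite (_root_.ConnectedComponents Y) ∧ Module.Finite k (CartanBundle.H0 p E) ∧
      Nat.card (_root_.ConnectedComponents Y) = Module.finrank k (CartanBundle.H0 p E) := by
  have := hX.isIntegral
  have := hX.isProper
  -- Being of finite type over a field, `X` has enough closed points for the conditions imposed
  -- there to control all sections.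
  have : JacobsonSpace X := LocallyOfFiniteType.jacobsonSpace p
  refine ⟨⟨?_, ?_⟩, ?_⟩
  · rintro ⟨Y, f, hf, ⟨φ⟩⟩
    exact ⟨(CartanBundle.AlgebraData.ofIso f φ).mulHom,
      (CartanBundle.AlgebraData.ofIso f φ).fiberMap_mulHom_injective,
      hf.isCartan_mulHom hE φ (CartanBundle.isSepClosed_residueField p)⟩
  · rintro ⟨α, -, hα⟩
    exact CartanBundle.IsCartan.exists_isEtaleCovering hE hα
  · rintro Y f hf ⟨φ⟩
    exact ⟨hf.surjective hE φ, hf.finite_connectedComponents, hf.card_connectedComponents p φ⟩
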